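/- All graphs are finite, simple and undirected. For a connected graph $G$ with vertices $v_1,\dots,v_n$, let $D(G)=(d_G(v_i,v_j))_{i,j}$ be its distance matrix, where $d_G(u,v)$ is the length of a shortest path between $u$ and $v$ in $G$, and let the distance spectral radius $\rho(G)$ be the largest eigenvalue of the real symmetric matrix $D(G)$. For $n\ge 4$, let the kite graph $K_4^{(n)}$ be the graph of order $n$ obtained from the complete graph $K_4$ by attaching a path of length $n-4$ at one of its vertices (that is, one end-vertex of the path is identified with that vertex). **Lemma.** If $G$ is a connected graph of order $n$ with maximum degree $\Delta(G)\ge 5$, then $$\rho(G)<\rho\bigl(K_4^{(n)}\bigr).$$ -/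

import Mathlib

/-- The distance matrix of a (connected) graph: the `(u, v)` entry is the length of a shortest
path between `u` and `v`. -/
noncomputable def SimpleGraph.distMatrix {V : Type*} (G : SimpleGraph V) : Matrix V V ℝ :=
  Matrix.of fun u v => (G.dist u v : ℝ)

theorem SimpleGraph.distMatrix_isHermitian {V : Type*} (G : SimpleGraph V) :
    G.distMatrix.IsHermitian := by
  ext u v
  simp [SimpleGraph.distMatrix, SimpleGraph.dist_comm]

/-- The distance spectral radius: the largest (real) eigenvalue of the distance matrix.
For a nonempty vertex set the supremum is attained, see `distSpectralRadius_isGreatest`. -/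
noncomputable def SimpleGraph.distSpectralRadius {V : Type*} [Fintype V] [DecidableEq V]
    (G : SimpleGraph V) : ℝ :=
  sSup (spectrum ℝ G.distMatrix)

theorem SimpleGraph.distSpectralRadius_isGreatest {V : Type*} [Fintype V] [DecidableEq V]
    [Nonempty V] (G : SimpleGraph V) :
    IsGreatest (spectrum ℝ G.distMatrix) G.distSpectralRadius := by
  have h := G.distMatrix_isHermitian.spectrum_real_eq_range_eigenvalues
  have hfin : (spectrum ℝ G.distMatrix).Finite := h ▸ Set.finite_range _
  have hne : (spectrum ℝ G.distMatrix).Nonempty := h ▸ Set.range_nonempty _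
  exact ⟨hne.csSup_mem hfin, fun _ hx => le_csSup hfin.bddAbove hx⟩

/-- The kite graph of order `n` (for `1 ≤ k ≤ n`): the vertices `0, …, k - 1` form a `k`-clique,
and the path `k - 1, k, …, n - 1` of length `n - k` is attached to it at the vertex `k - 1`. -/
def kiteGraph (k n : ℕ) : SimpleGraph (Fin n) where
  Adj i j := i ≠ j ∧ ((i.val < k ∧ j.val < k) ∨ i.val + 1 = j.val ∨ j.val + 1 = i.val)
  symm := ⟨fun i j h => ⟨h.1.symm, by omega⟩⟩
  loopless := ⟨fun _ h => h.1 rfl⟩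

/-! The comparison is by Rayleigh quotients. Let `x` be the positive Perron vector of `G`. If the
vertices can be placed on the kite so that the energy of `x` strictly increases, then `ρ(G)‖x‖² <
ρ(K)‖x‖²`. Energies of nonnegative weights are monotone in the distances, so `G` may be replaced by
a breadth-first tree rooted at a vertex `r` of degree at least 5. For order at least 7 the placement
exists for every positive weighting; this is `KiteDominated`, proved by induction on the order in
`IsRootedTree.kiteDominated`.

In the inductive step a leaf `l` is chosen that is no heavier than some other leaf `m`, and its
weight is merged into its parent `w`. This lowers the tree energy by at most `2 * x l` times the
remaining mass. The smaller tree has a good placement, and splitting `l` off from `w` on the kite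
regains at least that amount, provided that enough mass lies on the proper side of `w`. The vertex
`m` supplies the mass, except when `m` and `w` both sit in the clique end; there the placement is
taken optimal and `le_mass_of_optimal` applies (`KiteDominated.exists_insert`).

The irreducible trees are brooms (four leaves and a path at `r`) and the star with six leaves. For a
broom, either the lightest leaf is inserted between `r` and the path, or the heaviest leaf is moved
to the far end; `broom_inequality` shows that one of the two gains. The star has an explicit
placement.

Order 6 is separate because weightwise domination fails there: with weight near 0 on the centre and
1 on the five leaves the star has energy near 40, while no placement on the kite exceeds about 38.
The two spectral radii are separated by the number `43 / 5` instead. -/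

/-- The distance in the kite graph with a `4`-clique, as a function on vertex labels. -/
def kiteDist (i j : ℕ) : ℕ :=
  if i = j then 0 else if i < 3 ∧ j < 3 then 1 else (i - 2) - (j - 2) + ((j - 2) - (i - 2))

/-- The quadratic form of a distance function `δ` on the finite set `s`. -/
noncomputable def distEnergy {V : Type*} (δ : V → V → ℕ) (s : Finset V) (x : V → ℝ) : ℝ :=
  ∑ u ∈ s, ∑ v ∈ s, (δ u v : ℝ) * (x u * x v)

theorem kiteDist_comm (i j : ℕ) : kiteDist i j = kiteDist j i := by
  unfold kiteDist; split_ifs <;> omega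

theorem kiteDist_self (i : ℕ) : kiteDist i i = 0 := by
  simp [kiteDist]

theorem distEnergy_insert {V : Type*} [DecidableEq V] {δ : V → V → ℕ}
    (hs : ∀ u v, δ u v = δ v u) (h0 : ∀ u, δ u u = 0) (x : V → ℝ) {u : V} {s : Finset V}
    (hu : u ∉ s) :
    distEnergy δ (insert u s) x = distEnergy δ s x + 2 * (x u * ∑ v ∈ s, (δ u v : ℝ) * x v) := by
  unfold distEnergy
  rw [Finset.sum_insert hu]
  simp_rw [Finset.sum_insert hu]
  rw [Finset.sum_add_distrib, h0]
  have h1 : ∑ v ∈ s, (δ u v : ℝ) * (x u * x v) = x u * ∑ v ∈ s, (δ u v : ℝ) * x v := by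
    rw [Finset.mul_sum]; exact Finset.sum_congr rfl fun v _ => by ring
  have h2 : ∑ v ∈ s, (δ v u : ℝ) * (x v * x u) = x u * ∑ v ∈ s, (δ u v : ℝ) * x v := by
    rw [Finset.mul_sum]; exact Finset.sum_congr rfl fun v _ => by rw [hs v u]; ring
  rw [h1, h2]; push_cast; ring

theorem distEnergy_mono {V : Type*} {δ ε : V → V → ℕ} {s : Finset V} {x : V → ℝ}
    (hx : ∀ u ∈ s, 0 ≤ x u) (h : ∀ u ∈ s, ∀ v ∈ s, δ u v ≤ ε u v) :
    distEnergy δ s x ≤ distEnergy ε s x := by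
  unfold distEnergy
  refine Finset.sum_le_sum fun u hu => Finset.sum_le_sum fun v hv => ?_
  exact mul_le_mul_of_nonneg_right (by exact_mod_cast h u hu v hv) (mul_nonneg (hx u hu) (hx v hv))

/-- Every positive weighting of `s` admits a placement of `s` on the kite graph of the same order
for which the distance energy strictly increases. -/
def KiteDominated {V : Type*} (d : V → V → ℕ) (s : Finset V) : Prop :=
  ∀ x : V → ℝ, (∀ u ∈ s, 0 < x u) → ∃ σ : V → ℕ, Set.InjOn σ s ∧ (∀ u ∈ s, σ u < s.card) ∧
    distEnergy d s x < distEnergy (fun u v => kiteDist (σ u) (σ v)) s x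

theorem weighted_sum_le {V : Type*} {s : Finset V} {x : V → ℝ} (hx : ∀ u ∈ s, 0 ≤ x u)
    {f g : V → ℝ} (h : ∀ u ∈ s, f u ≤ g u) : ∑ v ∈ s, f v * x v ≤ ∑ v ∈ s, g v * x v :=
  Finset.sum_le_sum fun v hv => mul_le_mul_of_nonneg_right (h v hv) (hx v hv)

/-! ### Brooms -/

/-- A broom: four leaves `a, b, c, e` and a path `P` (levelled by `dep`) hanging at `r`; the
function `d` is at most the distance of the broom. -/
structure IsBroom {V : Type*} [DecidableEq V] (d : V → V → ℕ) (s P : Finset V) (dep : V → ℕ)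
    (a b c e r : V) : Prop where
  symm : ∀ u v, d u v = d v u
  self : ∀ u, d u u = 0
  eq_insert : s = insert a (insert b (insert c (insert e (insert r P))))
  ha : a ∉ insert b (insert c (insert e (insert r P)))
  hb : b ∉ insert c (insert e (insert r P))
  hc : c ∉ insert e (insert r P)
  he : e ∉ insert r P
  hr : r ∉ P
  inj : Set.InjOn dep P
  one_le_dep : ∀ u ∈ P, 1 ≤ dep u
  dep_le : ∀ u ∈ P, dep u ≤ P.card
  path_path : ∀ u ∈ P, ∀ v ∈ P, dep u ≤ dep v → d u v ≤ dep v - dep u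
  root_path : ∀ u ∈ P, d r u ≤ dep u
  leaf_path : ∀ l, (l = a ∨ l = b ∨ l = c ∨ l = e) → ∀ u ∈ P, d l u ≤ dep u + 1
  leaf_root : ∀ l, (l = a ∨ l = b ∨ l = c ∨ l = e) → d l r ≤ 1
  leaf_leaf : ∀ l, (l = a ∨ l = b ∨ l = c ∨ l = e) → ∀ m, (m = a ∨ m = b ∨ m = c ∨ m = e) →
    d l m ≤ 2

theorem IsBroom.energy_le {V : Type*} [DecidableEq V] {d : V → V → ℕ} {s P : Finset V}
    {dep : V → ℕ} {a b c e r : V} (h : IsBroom d s P dep a b c e r) {x : V → ℝ}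
    (hx : ∀ u ∈ s, 0 < x u) :
    distEnergy d s x ≤ distEnergy d P x + 2 * (x r * ∑ v ∈ P, (dep v : ℝ) * x v)
      + 2 * ((x a + x b + x c + x e) * (∑ v ∈ P, (dep v : ℝ) * x v + ∑ v ∈ P, x v + x r))
      + 4 * (x a * x b + x a * x c + x a * x e + x b * x c + x b * x e + x c * x e) := by
  have hs := h.eq_insert
  have hP : ∀ u ∈ P, 0 ≤ x u := fun u hu => (hx u (by simp [hs, hu])).le
  have xa := (hx a (by simp [hs])).le
  have xb := (hx b (by simp [hs])).le
  have xc := (hx c (by simp [hs])).le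
  have xe := (hx e (by simp [hs])).le
  have xr := (hx r (by simp [hs])).le
  rw [hs, distEnergy_insert h.symm h.self x h.ha, distEnergy_insert h.symm h.self x h.hb,
    distEnergy_insert h.symm h.self x h.hc, distEnergy_insert h.symm h.self x h.he,
    distEnergy_insert h.symm h.self x h.hr, Finset.sum_insert h.hb, Finset.sum_insert h.hc,
    Finset.sum_insert h.he, Finset.sum_insert h.hr, Finset.sum_insert h.hc,
    Finset.sum_insert h.he, Finset.sum_insert h.hr,
    Finset.sum_insert h.he, Finset.sum_insert h.hr, Finset.sum_insert h.hr]
  have key : ∀ l, (l = a ∨ l = b ∨ l = c ∨ l = e) → ∑ v ∈ P, (d l v : ℝ) * x v ≤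
      ∑ v ∈ P, (dep v : ℝ) * x v + ∑ v ∈ P, x v := by
    intro l hl
    rw [← Finset.sum_add_distrib]
    refine Finset.sum_le_sum fun v hv => ?_
    have : (d l v : ℝ) ≤ dep v + 1 := by exact_mod_cast h.leaf_path l hl v hv
    nlinarith [hP v hv]
  have keyr : ∑ v ∈ P, (d r v : ℝ) * x v ≤ ∑ v ∈ P, (dep v : ℝ) * x v :=
    weighted_sum_le hP fun v hv => by exact_mod_cast h.root_path v hv
  have kr : ∀ l, (l = a ∨ l = b ∨ l = c ∨ l = e) → (d l r : ℝ) * x r ≤ x r := by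
    intro l hl
    have : (d l r : ℝ) ≤ 1 := by exact_mod_cast h.leaf_root l hl
    nlinarith
  have kl : ∀ l, (l = a ∨ l = b ∨ l = c ∨ l = e) → ∀ m, (m = a ∨ m = b ∨ m = c ∨ m = e) →
      0 ≤ x m → (d l m : ℝ) * x m ≤ 2 * x m := by
    intro l hl m hm h0
    have : (d l m : ℝ) ≤ 2 := by exact_mod_cast h.leaf_leaf l hl m hm
    nlinarith
  have ia : a = a ∨ a = b ∨ a = c ∨ a = e := by simp
  have ib : b = a ∨ b = b ∨ b = c ∨ b = e := by simp
  have ic : c = a ∨ c = b ∨ c = c ∨ c = e := by simp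
  have ie : e = a ∨ e = b ∨ e = c ∨ e = e := by simp
  have A := mul_le_mul_of_nonneg_left (add_le_add (kl a ia b ib xb) (add_le_add (kl a ia c ic xc)
    (add_le_add (kl a ia e ie xe) (add_le_add (kr a ia) (key a ia))))) xa
  have B := mul_le_mul_of_nonneg_left (add_le_add (kl b ib c ic xc)
    (add_le_add (kl b ib e ie xe) (add_le_add (kr b ib) (key b ib)))) xb
  have C := mul_le_mul_of_nonneg_left
    (add_le_add (kl c ic e ie xe) (add_le_add (kr c ic) (key c ic))) xc
  have E := mul_le_mul_of_nonneg_left (add_le_add (kr e ie) (key e ie)) xe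
  have R := mul_le_mul_of_nonneg_left keyr xr
  linarith

/-- The leaf `e` goes between `r` and the path, and `a`, `b`, `c` fill the clique. The path moves
one step away from `a`, `b`, `c`, `r` and one step closer to `e`; the three pairs among `a`, `b`,
`c` drop from 2 to 1. -/
theorem IsBroom.exists_middle {V : Type*} [DecidableEq V] {d : V → V → ℕ} {s P : Finset V}
    {dep : V → ℕ} {a b c e r : V} (h : IsBroom d s P dep a b c e r) {x : V → ℝ}
    (hx : ∀ u ∈ s, 0 < x u) :
    ∃ σ : V → ℕ, Set.InjOn σ s ∧ (∀ u ∈ s, σ u < s.card) ∧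
      distEnergy d s x + 2 * ((x a + x b + x c + x r - x e) * ∑ v ∈ P, x v
        - (x a * x b + x a * x c + x b * x c)) ≤
      distEnergy (fun u v => kiteDist (σ u) (σ v)) s x := by
  have hs := h.eq_insert
  have hP : ∀ u ∈ P, 0 ≤ x u := fun u hu => (hx u (by simp [hs, hu])).le
  obtain ⟨hab, hac, hae, har, haP⟩ : a ≠ b ∧ a ≠ c ∧ a ≠ e ∧ a ≠ r ∧ a ∉ P := by
    simpa using h.ha
  obtain ⟨hbc, hbe, hbr, hbP⟩ : b ≠ c ∧ b ≠ e ∧ b ≠ r ∧ b ∉ P := by simpa using h.hb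
  obtain ⟨hce, hcr, hcP⟩ : c ≠ e ∧ c ≠ r ∧ c ∉ P := by simpa using h.hc
  obtain ⟨her, heP⟩ : e ≠ r ∧ e ∉ P := by simpa using h.he
  have hrP := h.hr
  have hcard : s.card = P.card + 5 := by
    rw [hs, Finset.card_insert_of_notMem h.ha, Finset.card_insert_of_notMem h.hb,
      Finset.card_insert_of_notMem h.hc, Finset.card_insert_of_notMem h.he,
      Finset.card_insert_of_notMem h.hr]
  let σ : V → ℕ := fun u => if u = a then 0 else if u = b then 1 else if u = c then 2 else
    if u = r then 3 else if u = e then 4 else 4 + dep u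
  have σa : σ a = 0 := by simp [σ]
  have σb : σ b = 1 := by simp [σ, hab.symm]
  have σc : σ c = 2 := by simp [σ, hac.symm, hbc.symm]
  have σr : σ r = 3 := by simp [σ, har.symm, hbr.symm, hcr.symm]
  have σe : σ e = 4 := by simp [σ, hae.symm, hbe.symm, hce.symm, her]
  have σP : ∀ u ∈ P, σ u = 4 + dep u := by
    intro u hu
    have : u ≠ a ∧ u ≠ b ∧ u ≠ c ∧ u ≠ r ∧ u ≠ e := by
      refine ⟨?_, ?_, ?_, ?_, ?_⟩ <;> rintro rfl <;> contradiction
    simp [σ, this]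
  clear_value σ
  refine ⟨σ, ?_, ?_, ?_⟩
  · intro u hu v hv huv
    simp only [hs, Finset.coe_insert, Set.mem_insert_iff, Finset.mem_coe] at hu hv
    have one := h.one_le_dep
    rcases hu with rfl | rfl | rfl | rfl | rfl | hu <;>
    rcases hv with rfl | rfl | rfl | rfl | rfl | hv <;> first
      | rfl
      | (exfalso; simp only [σa, σb, σc, σr, σe] at huv; omega)
      | (exfalso; have := σP _ hu; have := one _ hu; omega)
      | (exfalso; have := σP _ hv; have := one _ hv; omega)
      | (have h1 := σP _ hu; have h2 := σP _ hv; exact h.inj hu hv (by omega))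
  · intro u hu
    simp only [hs, Finset.mem_insert] at hu
    rw [hcard]
    rcases hu with rfl | rfl | rfl | rfl | rfl | hu <;> first
      | omega
      | (have := σP _ hu; have := h.dep_le _ hu; omega)
  · have up := h.energy_le hx
    set δ : V → V → ℕ := fun u v => kiteDist (σ u) (σ v) with hδ
    have δs : ∀ u v, δ u v = δ v u := fun u v => kiteDist_comm _ _
    have δ0 : ∀ u, δ u u = 0 := fun u => kiteDist_self _
    have low : distEnergy d P x ≤ distEnergy δ P x := by
      refine distEnergy_mono hP fun u hu v hv => ?_
      simp only [hδ, σP u hu, σP v hv]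
      have h1 := h.one_le_dep u hu
      have h2 := h.one_le_dep v hv
      rcases le_total (dep u) (dep v) with huv | huv
      · refine (h.path_path u hu v hv huv).trans ?_
        unfold kiteDist; split_ifs <;> omega
      · rw [h.symm]
        refine (h.path_path v hv u hu huv).trans ?_
        unfold kiteDist; split_ifs <;> omega
    have sumP : ∀ l : V, ∀ k : ℕ, (∀ v ∈ P, δ l v = dep v + k) →
        ∑ v ∈ P, (δ l v : ℝ) * x v = ∑ v ∈ P, (dep v : ℝ) * x v + k * ∑ v ∈ P, x v := by
      intro l k hl
      rw [Finset.mul_sum, ← Finset.sum_add_distrib]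
      refine Finset.sum_congr rfl fun v hv => ?_
      rw [hl v hv]; push_cast; ring
    have sa := sumP a 2 fun v hv => by
      simp only [hδ, σP v hv, σa]; unfold kiteDist; split_ifs <;> omega
    have sb := sumP b 2 fun v hv => by
      simp only [hδ, σP v hv, σb]; unfold kiteDist; split_ifs <;> omega
    have sc := sumP c 2 fun v hv => by
      simp only [hδ, σP v hv, σc]; unfold kiteDist; split_ifs <;> omega
    have sr := sumP r 1 fun v hv => by
      simp only [hδ, σP v hv, σr]; unfold kiteDist; split_ifs <;> omega
    have se := sumP e 0 fun v hv => by
      have := h.one_le_dep v hv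
      simp only [hδ, σP v hv, σe]; unfold kiteDist; split_ifs <;> omega
    have values : δ a b = 1 ∧ δ a c = 1 ∧ δ a r = 1 ∧ δ a e = 2 ∧ δ b c = 1 ∧ δ b r = 1 ∧
        δ b e = 2 ∧ δ c r = 1 ∧ δ c e = 2 ∧ δ e r = 1 := by
      simp only [hδ, σa, σb, σc, σr, σe]; decide
    obtain ⟨v1, v2, v3, v4, v5, v6, v7, v8, v9, v10⟩ := values
    rw [hs, distEnergy_insert δs δ0 x h.ha, distEnergy_insert δs δ0 x h.hb,
      distEnergy_insert δs δ0 x h.hc, distEnergy_insert δs δ0 x h.he,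
      distEnergy_insert δs δ0 x h.hr, Finset.sum_insert h.hb, Finset.sum_insert h.hc,
      Finset.sum_insert h.he, Finset.sum_insert h.hr, Finset.sum_insert h.hc,
      Finset.sum_insert h.he, Finset.sum_insert h.hr,
      Finset.sum_insert h.he, Finset.sum_insert h.hr, Finset.sum_insert h.hr,
      sa, sb, sc, sr, se, v1, v2, v3, v4, v5, v6, v7, v8, v9, v10]
    rw [hs] at up
    push_cast
    linarith

/-- The leaf `e` goes beyond the far end of the path. With `k = P.card`, it moves `k` steps away
from `a`, `b`, `c`, `r`, and its distance to a path vertex changes by `k - 2 * dep`, which is at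
least `-k`. -/
theorem IsBroom.exists_end {V : Type*} [DecidableEq V] {d : V → V → ℕ} {s P : Finset V}
    {dep : V → ℕ} {a b c e r : V} (h : IsBroom d s P dep a b c e r) {x : V → ℝ}
    (hx : ∀ u ∈ s, 0 < x u) :
    ∃ σ : V → ℕ, Set.InjOn σ s ∧ (∀ u ∈ s, σ u < s.card) ∧
      distEnergy d s x + 2 * (P.card * x e * (x a + x b + x c + x r - ∑ v ∈ P, x v)
        - (x a * x b + x a * x c + x b * x c)) ≤
      distEnergy (fun u v => kiteDist (σ u) (σ v)) s x := by
  have hs := h.eq_insert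
  have hP : ∀ u ∈ P, 0 ≤ x u := fun u hu => (hx u (by simp [hs, hu])).le
  have xe := (hx e (by simp [hs])).le
  obtain ⟨hab, hac, hae, har, haP⟩ : a ≠ b ∧ a ≠ c ∧ a ≠ e ∧ a ≠ r ∧ a ∉ P := by
    simpa using h.ha
  obtain ⟨hbc, hbe, hbr, hbP⟩ : b ≠ c ∧ b ≠ e ∧ b ≠ r ∧ b ∉ P := by simpa using h.hb
  obtain ⟨hce, hcr, hcP⟩ : c ≠ e ∧ c ≠ r ∧ c ∉ P := by simpa using h.hc
  obtain ⟨her, heP⟩ : e ≠ r ∧ e ∉ P := by simpa using h.he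
  have hrP := h.hr
  have hcard : s.card = P.card + 5 := by
    rw [hs, Finset.card_insert_of_notMem h.ha, Finset.card_insert_of_notMem h.hb,
      Finset.card_insert_of_notMem h.hc, Finset.card_insert_of_notMem h.he,
      Finset.card_insert_of_notMem h.hr]
  let σ : V → ℕ := fun u => if u = a then 0 else if u = b then 1 else if u = c then 2 else
    if u = r then 3 else if u = e then 4 + P.card else 3 + dep u
  have σa : σ a = 0 := by simp [σ]
  have σb : σ b = 1 := by simp [σ, hab.symm]
  have σc : σ c = 2 := by simp [σ, hac.symm, hbc.symm]
  have σr : σ r = 3 := by simp [σ, har.symm, hbr.symm, hcr.symm]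
  have σe : σ e = 4 + P.card := by simp [σ, hae.symm, hbe.symm, hce.symm, her]
  have σP : ∀ u ∈ P, σ u = 3 + dep u := by
    intro u hu
    have : u ≠ a ∧ u ≠ b ∧ u ≠ c ∧ u ≠ r ∧ u ≠ e := by
      refine ⟨?_, ?_, ?_, ?_, ?_⟩ <;> rintro rfl <;> contradiction
    simp [σ, this]
  clear_value σ
  refine ⟨σ, ?_, ?_, ?_⟩
  · intro u hu v hv huv
    simp only [hs, Finset.coe_insert, Set.mem_insert_iff, Finset.mem_coe] at hu hv
    have one := h.one_le_dep
    have top := h.dep_le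
    rcases hu with rfl | rfl | rfl | rfl | rfl | hu <;>
    rcases hv with rfl | rfl | rfl | rfl | rfl | hv <;> first
      | rfl
      | (exfalso; simp only [σa, σb, σc, σr, σe] at huv; omega)
      | (exfalso; have := σP _ hu; have := one _ hu; have := top _ hu; omega)
      | (exfalso; have := σP _ hv; have := one _ hv; have := top _ hv; omega)
      | (have h1 := σP _ hu; have h2 := σP _ hv; exact h.inj hu hv (by omega))
  · intro u hu
    simp only [hs, Finset.mem_insert] at hu
    rw [hcard]
    rcases hu with rfl | rfl | rfl | rfl | rfl | hu <;> first
      | omega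
      | (have := σP _ hu; have := h.dep_le _ hu; omega)
  · have up := h.energy_le hx
    set δ : V → V → ℕ := fun u v => kiteDist (σ u) (σ v) with hδ
    have δs : ∀ u v, δ u v = δ v u := fun u v => kiteDist_comm _ _
    have δ0 : ∀ u, δ u u = 0 := fun u => kiteDist_self _
    have low : distEnergy d P x ≤ distEnergy δ P x := by
      refine distEnergy_mono hP fun u hu v hv => ?_
      simp only [hδ, σP u hu, σP v hv]
      have h1 := h.one_le_dep u hu
      have h2 := h.one_le_dep v hv
      rcases le_total (dep u) (dep v) with huv | huv
      · refine (h.path_path u hu v hv huv).trans ?_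
        unfold kiteDist; split_ifs <;> omega
      · rw [h.symm]
        refine (h.path_path v hv u hu huv).trans ?_
        unfold kiteDist; split_ifs <;> omega
    have sumP : ∀ l : V, ∀ k : ℕ, (∀ v ∈ P, δ l v = dep v + k) →
        ∑ v ∈ P, (δ l v : ℝ) * x v = ∑ v ∈ P, (dep v : ℝ) * x v + k * ∑ v ∈ P, x v := by
      intro l k hl
      rw [Finset.mul_sum, ← Finset.sum_add_distrib]
      refine Finset.sum_congr rfl fun v hv => ?_
      rw [hl v hv]; push_cast; ring
    have sa := sumP a 1 fun v hv => by
      simp only [hδ, σP v hv, σa]; unfold kiteDist; split_ifs <;> omega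
    have sb := sumP b 1 fun v hv => by
      simp only [hδ, σP v hv, σb]; unfold kiteDist; split_ifs <;> omega
    have sc := sumP c 1 fun v hv => by
      simp only [hδ, σP v hv, σc]; unfold kiteDist; split_ifs <;> omega
    have sr := sumP r 0 fun v hv => by
      have := h.one_le_dep v hv
      simp only [hδ, σP v hv, σr]; unfold kiteDist; split_ifs <;> omega
    have se : ∑ v ∈ P, (δ e v : ℝ) * x v =
        (P.card + 1) * ∑ v ∈ P, x v - ∑ v ∈ P, (dep v : ℝ) * x v := by
      rw [Finset.mul_sum, ← Finset.sum_sub_distrib]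
      refine Finset.sum_congr rfl fun v hv => ?_
      have h1 := h.one_le_dep v hv
      have h2 := h.dep_le v hv
      have h3 : δ e v + dep v = P.card + 1 := by
        simp only [hδ, σP v hv, σe]; unfold kiteDist; split_ifs <;> omega
      have h4 : (δ e v : ℝ) + dep v = P.card + 1 := by exact_mod_cast h3
      linear_combination (x v) * h4
    have hQ : ∑ v ∈ P, (dep v : ℝ) * x v ≤ P.card * ∑ v ∈ P, x v := by
      rw [Finset.mul_sum]
      exact weighted_sum_le hP fun v hv => by exact_mod_cast h.dep_le v hv
    have values : δ a b = 1 ∧ δ a c = 1 ∧ δ a r = 1 ∧ δ a e = P.card + 2 ∧ δ b c = 1 ∧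
        δ b r = 1 ∧ δ b e = P.card + 2 ∧ δ c r = 1 ∧ δ c e = P.card + 2 ∧
        δ e r = P.card + 1 := by
      simp only [hδ, σa, σb, σc, σr, σe]
      refine ⟨?_, ?_, ?_, ?_, ?_, ?_, ?_, ?_, ?_, ?_⟩ <;> unfold kiteDist <;>
        split_ifs <;> omega
    obtain ⟨v1, v2, v3, v4, v5, v6, v7, v8, v9, v10⟩ := values
    rw [hs, distEnergy_insert δs δ0 x h.ha, distEnergy_insert δs δ0 x h.hb,
      distEnergy_insert δs δ0 x h.hc, distEnergy_insert δs δ0 x h.he,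
      distEnergy_insert δs δ0 x h.hr, Finset.sum_insert h.hb, Finset.sum_insert h.hc,
      Finset.sum_insert h.he, Finset.sum_insert h.hr, Finset.sum_insert h.hc,
      Finset.sum_insert h.he, Finset.sum_insert h.hr,
      Finset.sum_insert h.he, Finset.sum_insert h.hr, Finset.sum_insert h.hr,
      sa, sb, sc, sr, se, v1, v2, v3, v4, v5, v6, v7, v8, v9, v10]
    rw [hs] at up
    have := mul_le_mul_of_nonneg_left hQ xe
    push_cast
    linarith

/-- Here `D` and `e` stand for the heaviest and lightest leaf, `p` for the mass of the path and `k`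
for its number of vertices. The hypothesis `h1` says that moving the heaviest leaf to the end need
not gain; the conclusion says that inserting the lightest one in the middle does. Failure of the
first bounds `p` from below, failure of the second bounds it from above, and the bounds clash. -/
theorem broom_inequality {D b c e r p k : ℝ} (hb : b ≤ D) (hc : c ≤ D) (heb : e ≤ b)
    (hec : e ≤ c) (he : 0 < e) (hr : 0 < r) (hk : 2 ≤ k)
    (h1 : k * D * (e + b + c + r - p) ≤ e * b + e * c + b * c) :
    D * b + D * c + b * c < (D + b + c + r - e) * p := by
  have hb0 : 0 < b := by linarith
  have hc0 : 0 < c := by linarith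
  have hD0 : 0 < D := by linarith
  by_contra! h2
  obtain ⟨q, hq⟩ : ∃ q, q = (b + c) / 2 := ⟨_, rfl⟩
  obtain ⟨M, hM⟩ : ∃ M, M = e + b + c := ⟨_, rfl⟩
  have hI : 3 * (e * b + e * c + b * c) ≤ M ^ 2 := by
    rw [hM]; nlinarith [sq_nonneg (e - b), sq_nonneg (e - c), sq_nonneg (b - c)]
  -- This is the lower bound on `p`, from `k ≥ 2`, `r > 0` and `hI`.
  have h3 : 6 * D * (M - p) < M ^ 2 := by
    rcases le_total 0 (M + r - p) with h | h
    · have : 2 * (D * (M + r - p)) ≤ k * (D * (M + r - p)) :=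
        mul_le_mul_of_nonneg_right hk (mul_nonneg hD0.le h)
      have h4 : D * (M - p) < D * (M + r - p) := mul_lt_mul_of_pos_left (by linarith) hD0
      have h5 : k * D * (M + r - p) ≤ e * b + e * c + b * c := by rw [hM]; linarith
      linarith
    · have : D * (M - p) < 0 := mul_neg_of_pos_of_neg hD0 (by linarith)
      have : 0 < M ^ 2 := pow_pos (by linarith) 2
      linarith
  have hp : 0 < p := by
    by_contra! hp
    have h6 : D * M ≤ D * (M - p) := mul_le_mul_of_nonneg_left (by linarith) hD0.le
    have h7 : M * M ≤ 3 * D * M := mul_le_mul_of_nonneg_right (by linarith) (by linarith)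
    have : 0 < D * M := mul_pos hD0 (by linarith)
    nlinarith
  -- This is the upper bound on `p`: the term with `r` is dropped, and `b * c` is at most the square
  -- of the mean `q`.
  have h4 : (D + 2 * q - e) * p ≤ 2 * D * q + q ^ 2 := by
    have : 0 < r * p := mul_pos hr hp
    subst hq
    nlinarith [sq_nonneg (b - c)]
  have h5 : (D + 2 * q - e) * (6 * D * M - M ^ 2) < 6 * D * (2 * D * q + q ^ 2) := by
    have h6 : (D + 2 * q - e) * (6 * D * M - M ^ 2) < (D + 2 * q - e) * (6 * D * p) :=
      mul_lt_mul_of_pos_left (by linarith) (by linarith)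
    have h7 := mul_le_mul_of_nonneg_left h4 (by linarith : 0 ≤ 6 * D)
    linarith
  -- With `p` eliminated, `h5` is a cubic inequality in `D`, `q`, `e`. In the variables `q`, `t = D
  -- - q`, `u = q - e` its left side minus its right side is six times the expression in `e1` plus
  -- those in `e2` and `e3`, hence nonnegative.
  obtain ⟨t, ht⟩ : ∃ t, t = D - q := ⟨_, rfl⟩
  obtain ⟨u, hu⟩ : ∃ u, u = q - e := ⟨_, rfl⟩
  have hM' : M = 3 * q - u := by linarith
  have hD' : D = q + t := by linarith
  have he' : e = q - u := by linarith
  have ht0 : 0 ≤ t := by linarith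
  have hu0 : 0 ≤ u := by linarith
  have huq : 0 ≤ q - u := by linarith
  rw [hM', hD', he'] at h5
  have e1 : 0 ≤ t ^ 2 * (q - u) := by positivity
  have e2 : 0 ≤ t * ((q - u) * (15 * q + 21 * u) + 14 * u ^ 2) := by
    have : 0 ≤ q := by linarith
    positivity
  have e3 : 0 ≤ u * ((q - u) * (9 * q + 7 * u) + 6 * u ^ 2) := by
    have : 0 ≤ q := by linarith
    positivity
  nlinarith

theorem kiteDominated_of_broom {V : Type*} [DecidableEq V] {d : V → V → ℕ} {s P : Finset V}
    {dep : V → ℕ} {a b c e r : V} (hP : 2 ≤ P.card) (h : IsBroom d s P dep a b c e r)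
    (h' : IsBroom d s P dep e b c a r) {x : V → ℝ} (hx : ∀ u ∈ s, 0 < x u)
    (hb : x b ≤ x a) (hc : x c ≤ x a) (heb : x e ≤ x b) (hec : x e ≤ x c) :
    ∃ σ : V → ℕ, Set.InjOn σ s ∧ (∀ u ∈ s, σ u < s.card) ∧
      distEnergy d s x < distEnergy (fun u v => kiteDist (σ u) (σ v)) s x := by
  have xe := hx e (by simp [h.eq_insert])
  have xr := hx r (by simp [h.eq_insert])
  by_cases h1 : P.card * x a * (x e + x b + x c + x r - ∑ v ∈ P, x v) ≤
      x e * x b + x e * x c + x b * x c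
  · obtain ⟨σ, i, j, k⟩ := h.exists_middle hx
    have := broom_inequality hb hc heb hec xe xr (by exact_mod_cast hP) h1
    exact ⟨σ, i, j, by linarith⟩
  · obtain ⟨σ, i, j, k⟩ := h'.exists_end hx
    push Not at h1
    exact ⟨σ, i, j, by linarith⟩

/-! ### Stars -/

theorem star_energy_le {V : Type*} [DecidableEq V] {d : V → V → ℕ} (hs : ∀ u v, d u v = d v u)
    (h0 : ∀ u, d u u = 0) {r : V} {F : Finset V} (hr : r ∉ F) (h1 : ∀ u ∈ F, d r u ≤ 1)
    (h2 : ∀ u ∈ F, ∀ v ∈ F, d u v ≤ 2) {x : V → ℝ} (hx : ∀ u ∈ insert r F, 0 ≤ x u) :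
    distEnergy d (insert r F) x ≤
      2 * (x r * ∑ v ∈ F, x v) + 2 * ((∑ v ∈ F, x v) ^ 2 - ∑ v ∈ F, x v ^ 2) := by
  have hF : ∀ u ∈ F, 0 ≤ x u := fun u hu => hx u (by simp [hu])
  rw [distEnergy_insert hs h0 x hr]
  have A : ∑ v ∈ F, (d r v : ℝ) * x v ≤ ∑ v ∈ F, x v := by
    refine (weighted_sum_le (g := fun _ => 1) hF fun v hv => ?_).trans (by simp)
    exact_mod_cast h1 v hv
  have B : distEnergy d F x ≤ 2 * ((∑ v ∈ F, x v) ^ 2 - ∑ v ∈ F, x v ^ 2) := by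
    have : ∀ u ∈ F, ∑ v ∈ F, (d u v : ℝ) * (x u * x v) ≤
        2 * (x u * ∑ v ∈ F, x v) - 2 * x u ^ 2 := by
      intro u hu
      have e1 : 2 * x u ^ 2 = ∑ v ∈ F, if v = u then 2 * x u ^ 2 else 0 := by simp [hu]
      rw [e1, Finset.mul_sum, Finset.mul_sum, ← Finset.sum_sub_distrib]
      refine Finset.sum_le_sum fun v hv => ?_
      split_ifs with hvu
      · subst hvu; simp [h0]; nlinarith
      · have : (d u v : ℝ) ≤ 2 := by exact_mod_cast h2 u hu v hv
        have := mul_le_mul_of_nonneg_right this (mul_nonneg (hF u hu) (hF v hv))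
        linarith
    refine (Finset.sum_le_sum this).trans ?_
    rw [Finset.sum_sub_distrib, ← Finset.mul_sum, ← Finset.mul_sum, ← Finset.sum_mul]
    apply le_of_eq; ring
  have := mul_le_mul_of_nonneg_left A (hx r (by simp))
  linarith

/-- The heaviest leaf `g` goes to the far end of the kite, the second heaviest `a` into the clique,
and the centre `r` to the attaching vertex. -/
theorem kiteDominated_of_star {V : Type*} [DecidableEq V] {d : V → V → ℕ}
    (hs : ∀ u v, d u v = d v u) (h0 : ∀ u, d u u = 0) {r : V} {F : Finset V} (hr : r ∉ F)
    (h1 : ∀ u ∈ F, d r u ≤ 1) (h2 : ∀ u ∈ F, ∀ v ∈ F, d u v ≤ 2) (hF : F.card = 6) :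
    KiteDominated d (insert r F) := by
  intro x hx
  have up := star_energy_le hs h0 hr h1 h2 fun u hu => (hx u hu).le
  obtain ⟨g, hgF, hg⟩ := F.exists_max_image x (Finset.card_pos.1 (by omega))
  have c1 : (F.erase g).card = 5 := by rw [Finset.card_erase_of_mem hgF, hF]
  obtain ⟨a, haF, ha⟩ := (F.erase g).exists_max_image x (Finset.card_pos.1 (by omega))
  have c2 : ((F.erase g).erase a).card = 3 + 1 := by rw [Finset.card_erase_of_mem haF, c1]
  obtain ⟨b, T, hbT, hT, c3⟩ := Finset.card_eq_succ.1 c2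
  obtain ⟨c, f, e, hcf, hce, hfe, rfl⟩ := Finset.card_eq_three.1 c3
  have hFeq : F = {g, a, b, c, f, e} := by
    rw [← Finset.insert_erase hgF, ← Finset.insert_erase haF, ← hT]
  have hfa := ha f (by
    have : f ∈ (F.erase g).erase a := by rw [← hT]; simp
    exact Finset.mem_of_mem_erase this)
  have hea := ha e (by
    have : e ∈ (F.erase g).erase a := by rw [← hT]; simp
    exact Finset.mem_of_mem_erase this)
  have hag : x a ≤ x g := hg a (Finset.mem_of_mem_erase haF)
  have hbg : x b ≤ x g := hg b (by simp [hFeq])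
  have hcg : x c ≤ x g := hg c (by simp [hFeq])
  have na : a ∉ ({b, c, f, e} : Finset V) := by rw [hT]; simp
  have ng : g ∉ ({a, b, c, f, e} : Finset V) := by
    intro h
    have : g ∈ F.erase g := by rw [← Finset.insert_erase haF, ← hT]; exact h
    simp at this
  subst hFeq
  have nr := hr
  have nb := hbT
  have ng' := ng
  have na' := na
  have nc : c ∉ ({f, e} : Finset V) := by simp [hcf, hce]
  have nf : f ∉ ({e} : Finset V) := by simp [hfe]
  simp only [Finset.mem_insert, Finset.mem_singleton, not_or] at hr hbT na ng
  obtain ⟨rg, ra, rb, rc, rf, re⟩ := hr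
  obtain ⟨bc, bf, be⟩ := hbT
  obtain ⟨ab, ac, af, ae⟩ := na
  obtain ⟨ga, gb, gc, gf, ge⟩ := ng
  let σ : V → ℕ := fun u => if u = a then 0 else if u = b then 1 else if u = c then 2 else
    if u = r then 3 else if u = f then 4 else if u = e then 5 else 6
  have σa : σ a = 0 := by simp [σ]
  have σb : σ b = 1 := by simp [σ, Ne.symm ab]
  have σc : σ c = 2 := by simp [σ, Ne.symm ac, Ne.symm bc]
  have σr : σ r = 3 := by simp [σ, ra, rb, rc]
  have σf : σ f = 4 := by simp [σ, Ne.symm af, Ne.symm bf, Ne.symm hcf, Ne.symm rf]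
  have σe : σ e = 5 := by
    simp [σ, Ne.symm ae, Ne.symm be, Ne.symm hce, Ne.symm re, Ne.symm hfe]
  have σg : σ g = 6 := by simp [σ, ga, gb, gc, gf, ge, Ne.symm rg]
  clear_value σ
  have card : (insert r {g, a, b, c, f, e} : Finset V).card = 7 := by
    rw [Finset.card_insert_of_notMem nr, hF]
  refine ⟨σ, ?_, ?_, ?_⟩
  · intro u hu v hv huv
    simp only [Finset.coe_insert, Set.mem_insert_iff, Finset.coe_singleton,
      Set.mem_singleton_iff] at hu hv
    rcases hu with rfl | rfl | rfl | rfl | rfl | rfl | rfl <;>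
    rcases hv with rfl | rfl | rfl | rfl | rfl | rfl | rfl <;> first
      | rfl
      | (exfalso; omega)
  · intro u hu
    rw [card]
    simp only [Finset.mem_insert, Finset.mem_singleton] at hu
    rcases hu with rfl | rfl | rfl | rfl | rfl | rfl | rfl <;> omega
  · refine up.trans_lt ?_
    have pos : 0 < x a ∧ 0 < x b ∧ 0 < x c ∧ 0 < x r ∧ 0 < x f ∧ 0 < x e ∧ 0 < x g := by
      refine ⟨?_, ?_, ?_, ?_, ?_, ?_, ?_⟩ <;> exact hx _ (by simp)
    obtain ⟨pa, pb, pc, pr, pf, pe, pg⟩ := pos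
    set δ : V → V → ℕ := fun u v => kiteDist (σ u) (σ v) with hδ
    have δs : ∀ u v, δ u v = δ v u := fun u v => kiteDist_comm _ _
    have δ0 : ∀ u, δ u u = 0 := fun u => kiteDist_self _
    have E : distEnergy δ (insert r {g, a, b, c, f, e}) x =
        2 * (x r * (3 * x g + x a + x b + x c + x f + 2 * x e)
          + x g * (4 * (x a + x b + x c) + 2 * x f + x e)
          + x a * (x b + x c + 2 * x f + 3 * x e) + x b * (x c + 2 * x f + 3 * x e)
          + x c * (2 * x f + 3 * x e) + x f * x e) := by
      rw [distEnergy_insert δs δ0 x nr, distEnergy_insert δs δ0 x ng',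
        distEnergy_insert δs δ0 x na', distEnergy_insert δs δ0 x nb,
        distEnergy_insert δs δ0 x nc, distEnergy_insert δs δ0 x nf]
      simp only [Finset.sum_insert ng', Finset.sum_insert na', Finset.sum_insert nb,
        Finset.sum_insert nc, Finset.sum_insert nf, Finset.sum_singleton, distEnergy]
      simp only [hδ, σa, σb, σc, σr, σf, σe, σg]
      norm_num [kiteDist]
      ring
    rw [E]
    have S1 : ∑ v ∈ ({g, a, b, c, f, e} : Finset V), x v = x g + x a + x b + x c + x f + x e := by
      simp only [Finset.sum_insert ng', Finset.sum_insert na', Finset.sum_insert nb,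
        Finset.sum_insert nc, Finset.sum_insert nf, Finset.sum_singleton]
      ring
    have S2 : ∑ v ∈ ({g, a, b, c, f, e} : Finset V), x v ^ 2 =
        x g ^ 2 + x a ^ 2 + x b ^ 2 + x c ^ 2 + x f ^ 2 + x e ^ 2 := by
      simp only [Finset.sum_insert ng', Finset.sum_insert na', Finset.sum_insert nb,
        Finset.sum_insert nc, Finset.sum_insert nf, Finset.sum_singleton]
      ring
    rw [S1, S2]
    -- Only the pairs `ab`, `ac`, `bc`, `ge`, `fe` lose distance, one each. `t1` to `t5` charge them
    -- to distinct gains, using that `g` and `a` are heaviest; the rest is a positive surplus.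
    have t1 : x a * x b ≤ x g * x b := mul_le_mul_of_nonneg_right hag pb.le
    have t2 : x a * x c ≤ x a * x g := mul_le_mul_of_nonneg_left hcg pa.le
    have t3 : x b * x c ≤ x g * x c := mul_le_mul_of_nonneg_right hbg pc.le
    have t4 : x g * x e ≤ x g * x a := mul_le_mul_of_nonneg_left hea pg.le
    have t5 : x e * x f ≤ x e * x a := mul_le_mul_of_nonneg_left hfa pe.le
    have t6 : 0 < x r * (x e + 2 * x g) := by positivity
    have t7 : 0 < x b * x e := by positivity
    have t8 : 0 < x c * x e := by positivity
    have t9 : 0 < x g * x b := by positivity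
    have t10 : 0 < x g * x c := by positivity
    linarith

/-! ### Merging a leaf into its parent and splitting it off on the kite -/

theorem distEnergy_congr {V : Type*} {δ ε : V → V → ℕ} {s : Finset V} {x y : V → ℝ}
    (h : ∀ u ∈ s, ∀ v ∈ s, δ u v = ε u v) (hxy : ∀ u ∈ s, x u = y u) :
    distEnergy δ s x = distEnergy ε s y :=
  Finset.sum_congr rfl fun u hu => Finset.sum_congr rfl fun v hv => by
    rw [h u hu v hv, hxy u hu, hxy v hv]

/-- Increasing by one all the distances across a cut. -/
theorem distEnergy_add_cut_le {V : Type*} {δ ε : V → V → ℕ} {T : Finset V} {x : V → ℝ}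
    (hx : ∀ u ∈ T, 0 ≤ x u) (p : V → Prop) [DecidablePred p] (hε : ∀ u v, ε u v = ε v u)
    (hδ : ∀ u v, δ u v = δ v u) (h : ∀ u ∈ T, ∀ v ∈ T, δ u v ≤ ε u v)
    (hp : ∀ u ∈ T, ∀ v ∈ T, p u → ¬ p v → δ u v + 1 ≤ ε u v) :
    distEnergy δ T x + 2 * ((∑ u ∈ T with p u, x u) * ∑ u ∈ T with ¬ p u, x u) ≤
      distEnergy ε T x := by
  rw [Finset.sum_filter, Finset.sum_filter]
  have e1 : 2 * ((∑ u ∈ T, if p u then x u else 0) * ∑ u ∈ T, if ¬ p u then x u else 0) =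
      ∑ u ∈ T, ∑ v ∈ T, ((if p u then x u else 0) * (if ¬ p v then x v else 0)
        + (if ¬ p u then x u else 0) * (if p v then x v else 0)) := by
    simp_rw [Finset.sum_add_distrib, ← Finset.mul_sum, ← Finset.sum_mul]
    ring
  rw [e1]
  unfold distEnergy
  rw [← Finset.sum_add_distrib]
  refine Finset.sum_le_sum fun u hu => ?_
  rw [← Finset.sum_add_distrib]
  refine Finset.sum_le_sum fun v hv => ?_
  have pos := mul_nonneg (hx u hu) (hx v hv)
  have h1 : (δ u v : ℝ) ≤ ε u v := by exact_mod_cast h u hu v hv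
  have h1' := mul_le_mul_of_nonneg_right h1 pos
  by_cases pu : p u <;> by_cases pv : p v <;> simp only [pu, pv, if_true, if_false, not_true,
    not_false_eq_true]
  · linarith
  · have h2 : (δ u v : ℝ) + 1 ≤ ε u v := by exact_mod_cast hp u hu v hv pu pv
    have := mul_le_mul_of_nonneg_right h2 pos
    linarith
  · have h2 : (δ u v : ℝ) + 1 ≤ ε u v := by
      have := hp v hv u hu pv pu
      rw [hδ, hε] at this
      exact_mod_cast this
    have := mul_le_mul_of_nonneg_right h2 pos
    linarith
  · linarith

theorem distEnergy_merge {V : Type*} [DecidableEq V] {δ : V → V → ℕ}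
    (hs : ∀ u v, δ u v = δ v u) (h0 : ∀ u, δ u u = 0) (x : V → ℝ) {w : V} {T : Finset V}
    (hw : w ∉ T) (t : ℝ) :
    distEnergy δ (insert w T) (Function.update x w t) =
      distEnergy δ T x + 2 * (t * ∑ v ∈ T, (δ w v : ℝ) * x v) := by
  have hne : ∀ u ∈ T, Function.update x w t u = x u := fun u hu =>
    Function.update_of_ne (by rintro rfl; exact hw hu) _ _
  rw [distEnergy_insert hs h0 _ hw, Function.update_self]
  congr 1
  · exact distEnergy_congr (fun _ _ _ _ => rfl) hne
  · congr 2
    exact Finset.sum_congr rfl fun v hv => by rw [hne v hv]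

/-- Shifting the weight of `l` onto `w` shortens each distance from `l` by at most 1, so it costs at
most `2 * x l` times the mass of all other vertices. -/
theorem distEnergy_insert_le_merge {V : Type*} [DecidableEq V] {d : V → V → ℕ}
    (hs : ∀ u v, d u v = d v u) (h0 : ∀ u, d u u = 0) {x : V → ℝ} {l w : V} {T : Finset V}
    (hw : w ∉ T) (hl : l ∉ insert w T) (hx : ∀ u ∈ insert l (insert w T), 0 ≤ x u)
    (hd : ∀ v, d l v ≤ d w v + 1) :
    distEnergy d (insert l (insert w T)) x ≤
      distEnergy d (insert w T) (Function.update x w (x w + x l))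
        + 2 * (x l * (x w + ∑ v ∈ T, x v)) := by
  rw [distEnergy_merge hs h0 x hw, distEnergy_insert hs h0 x hl, distEnergy_insert hs h0 x hw,
    Finset.sum_insert hw]
  have a : ∑ v ∈ T, (d l v : ℝ) * x v ≤ ∑ v ∈ T, (d w v : ℝ) * x v + ∑ v ∈ T, x v := by
    rw [← Finset.sum_add_distrib]
    refine Finset.sum_le_sum fun v hv => ?_
    have h1 : (d l v : ℝ) ≤ d w v + 1 := by exact_mod_cast hd v
    have := mul_le_mul_of_nonneg_right h1 (hx v (by simp [hv]))
    linarith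
  have b : (d l w : ℝ) * x w ≤ x w := by
    have h1 : (d l w : ℝ) ≤ 1 := by have := hd w; rw [h0] at this; exact_mod_cast this
    have := mul_le_mul_of_nonneg_right h1 (hx w (by simp))
    linarith
  have := mul_le_mul_of_nonneg_left (add_le_add b a) (hx l (by simp))
  linarith

theorem sum_add_filter_le {V : Type*} {δ ε : V → ℕ} {T : Finset V} {x : V → ℝ}
    (hx : ∀ u ∈ T, 0 ≤ x u) (p : V → Prop) [DecidablePred p] (h : ∀ u ∈ T, δ u ≤ ε u)
    (hp : ∀ u ∈ T, p u → δ u + 1 ≤ ε u) :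
    ∑ v ∈ T, (δ v : ℝ) * x v + ∑ v ∈ T with p v, x v ≤ ∑ v ∈ T, (ε v : ℝ) * x v := by
  rw [Finset.sum_filter, ← Finset.sum_add_distrib]
  refine Finset.sum_le_sum fun v hv => ?_
  split_ifs with pv
  · have h1 : (δ v : ℝ) + 1 ≤ ε v := by exact_mod_cast hp v hv pv
    have := mul_le_mul_of_nonneg_right h1 (hx v hv)
    linarith
  · have h1 : (δ v : ℝ) ≤ ε v := by exact_mod_cast h v hv
    have := mul_le_mul_of_nonneg_right h1 (hx v hv)
    linarith

/-- A new vertex `l` placed just to the right of `w`. -/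
theorem energy_insert_right {V : Type*} [DecidableEq V] {δ ε : V → V → ℕ} {T : Finset V}
    {x : V → ℝ} {l w : V} (p : V → Prop) [DecidablePred p]
    (hw : w ∉ T) (hl : l ∉ insert w T) (hx : ∀ u ∈ insert l (insert w T), 0 ≤ x u)
    (hε : ∀ u v, ε u v = ε v u) (hδ : ∀ u v, δ u v = δ v u) (ε0 : ∀ u, ε u u = 0)
    (δ0 : ∀ u, δ u u = 0)
    (h : ∀ u ∈ T, ∀ v ∈ T, δ u v ≤ ε u v)
    (hp : ∀ u ∈ T, ∀ v ∈ T, p u → ¬ p v → δ u v + 1 ≤ ε u v)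
    (hwT : ∀ v ∈ T, δ w v ≤ ε w v) (hwR : ∀ v ∈ T, ¬ p v → δ w v + 1 ≤ ε w v)
    (hlT : ∀ v ∈ T, δ w v ≤ ε l v) (hlL : ∀ v ∈ T, p v → δ w v + 1 ≤ ε l v)
    (hlw : 1 ≤ ε l w) (hmass : x l ≤ x w + ∑ u ∈ T with p u, x u) :
    distEnergy δ (insert w T) (Function.update x w (x w + x l))
        + 2 * (x l * (x w + ∑ v ∈ T, x v)) ≤ distEnergy ε (insert l (insert w T)) x := by
  have hT : ∀ u ∈ T, 0 ≤ x u := fun u hu => hx u (by simp [hu])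
  have xl := hx l (by simp)
  have xw := hx w (by simp)
  have c := distEnergy_add_cut_le hT p hε hδ h hp
  have a := mul_le_mul_of_nonneg_left (sum_add_filter_le hT (fun v => ¬ p v) hwT hwR) xw
  have b := mul_le_mul_of_nonneg_left (sum_add_filter_le hT p hlT hlL) xl
  have e : x w ≤ (ε l w : ℝ) * x w := by
    have : (1 : ℝ) ≤ ε l w := by exact_mod_cast hlw
    nlinarith
  have e' := mul_le_mul_of_nonneg_left e xl
  rw [distEnergy_merge hδ δ0 x hw, distEnergy_insert hε ε0 x hl, distEnergy_insert hε ε0 x hw,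
    Finset.sum_insert hw]
  rw [← Finset.sum_filter_add_sum_filter_not T p x]
  have R0 : 0 ≤ ∑ u ∈ T with ¬ p u, x u :=
    Finset.sum_nonneg fun u hu => hT u (Finset.mem_filter.1 hu).1
  -- With `L` and `R` the masses of `T` on the two sides, half the gain is at least `L * R + x w * R
  -- + x l * L + x l * x w`, against a target of `x l * (x w + L + R)`. What is missing is `x l * R
  -- ≤ (x w + L) * R`.
  have := mul_le_mul_of_nonneg_right hmass R0
  linarith

/-- A new vertex `l` takes the place of `w`, which moves one step to the right. -/
theorem energy_insert_left {V : Type*} [DecidableEq V] {δ ε : V → V → ℕ} {T : Finset V}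
    {x : V → ℝ} {l w : V} (p : V → Prop) [DecidablePred p]
    (hw : w ∉ T) (hl : l ∉ insert w T) (hx : ∀ u ∈ insert l (insert w T), 0 ≤ x u)
    (hε : ∀ u v, ε u v = ε v u) (hδ : ∀ u v, δ u v = δ v u) (ε0 : ∀ u, ε u u = 0)
    (δ0 : ∀ u, δ u u = 0)
    (h : ∀ u ∈ T, ∀ v ∈ T, δ u v ≤ ε u v)
    (hp : ∀ u ∈ T, ∀ v ∈ T, p u → ¬ p v → δ u v + 1 ≤ ε u v)
    (hwT : ∀ v ∈ T, δ w v ≤ ε w v)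
    (hlT : ∀ v ∈ T, δ w v ≤ ε l v) (hlR : ∀ v ∈ T, ¬ p v → δ w v + 1 ≤ ε l v)
    (hlw : 1 ≤ ε l w) (hmass : x l ≤ ∑ u ∈ T with ¬ p u, x u) :
    distEnergy δ (insert w T) (Function.update x w (x w + x l))
        + 2 * (x l * (x w + ∑ v ∈ T, x v)) ≤ distEnergy ε (insert l (insert w T)) x := by
  have hT : ∀ u ∈ T, 0 ≤ x u := fun u hu => hx u (by simp [hu])
  have xl := hx l (by simp)
  have xw := hx w (by simp)
  have c := distEnergy_add_cut_le hT p hε hδ h hp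
  have a := mul_le_mul_of_nonneg_left (weighted_sum_le (f := fun v => (δ w v : ℝ))
    (g := fun v => (ε w v : ℝ)) hT fun v hv => by exact_mod_cast hwT v hv) xw
  have b := mul_le_mul_of_nonneg_left (sum_add_filter_le hT (fun v => ¬ p v) hlT hlR) xl
  have e : x w ≤ (ε l w : ℝ) * x w := by
    have : (1 : ℝ) ≤ ε l w := by exact_mod_cast hlw
    nlinarith
  have e' := mul_le_mul_of_nonneg_left e xl
  rw [distEnergy_merge hδ δ0 x hw, distEnergy_insert hε ε0 x hl, distEnergy_insert hε ε0 x hw,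
    Finset.sum_insert hw]
  rw [← Finset.sum_filter_add_sum_filter_not T p x]
  have L0 : 0 ≤ ∑ u ∈ T with p u, x u :=
    Finset.sum_nonneg fun u hu => hT u (Finset.mem_filter.1 hu).1
  -- Half the gain is at least `L * R + x l * R + x l * x w`, against the same target; what is
  -- missing is `x l * L ≤ R * L`.
  have := mul_le_mul_of_nonneg_left hmass L0
  linarith

theorem exists_optimal_placement {V : Type*} {s : Finset V} {x : V → ℝ}
    {σ₀ : V → ℕ} (h₀ : Set.InjOn σ₀ s) (h₁ : ∀ u ∈ s, σ₀ u < s.card) :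
    ∃ σ : V → ℕ, Set.InjOn σ s ∧ (∀ u ∈ s, σ u < s.card) ∧
      ∀ τ : V → ℕ, Set.InjOn τ s → (∀ u ∈ s, τ u < s.card) →
        distEnergy (fun u v => kiteDist (τ u) (τ v)) s x ≤
          distEnergy (fun u v => kiteDist (σ u) (σ v)) s x := by
  classical
  let ext : (s → Fin s.card) → V → ℕ := fun f u => if h : u ∈ s then f ⟨u, h⟩ else 0
  let res : ∀ τ : V → ℕ, (∀ u ∈ s, τ u < s.card) → s → Fin s.card :=
    fun τ h u => ⟨τ u, h u u.2⟩
  have ext_res : ∀ τ h, ∀ u ∈ s, ext (res τ h) u = τ u := by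
    intro τ h u hu
    simp [ext, res, hu]
  have res_inj : ∀ τ h, Set.InjOn τ s → Function.Injective (res τ h) := by
    intro τ h hτ u v huv
    exact Subtype.ext (hτ u.2 v.2 (by simpa [res] using huv))
  obtain ⟨f, hf, hmax⟩ := (Finset.univ.filter fun f : s → Fin s.card =>
    Function.Injective f).exists_max_image
      (fun f => distEnergy (fun u v => kiteDist (ext f u) (ext f v)) s x)
      ⟨res σ₀ h₁, by simpa using res_inj σ₀ h₁ h₀⟩
  have hf' : Function.Injective f := by simpa using hf
  refine ⟨ext f, ?_, ?_, ?_⟩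
  · intro u hu v hv huv
    have hu' : u ∈ s := hu
    have hv' : v ∈ s := hv
    simp only [ext, hu', hv', dif_pos] at huv
    exact congrArg Subtype.val (hf' (Fin.ext huv))
  · intro u hu
    simp [ext, hu]
  · intro τ hτ hτ'
    refine le_trans (le_of_eq ?_) (hmax (res τ hτ') (by simpa using res_inj τ hτ' hτ))
    exact distEnergy_congr (fun u hu v hv => by rw [ext_res τ hτ' u hu, ext_res τ hτ' v hv])
      fun _ _ => rfl

/-- In an optimal placement the mass on the path is not smaller than the smaller one of the
masses of any two vertices in the clique end. -/
theorem le_mass_of_optimal {V : Type*} [DecidableEq V] {s : Finset V} {x : V → ℝ}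
    (hx : ∀ u ∈ s, 0 < x u) {σ : V → ℕ} (hσ : Set.InjOn σ s) (hσ' : ∀ u ∈ s, σ u < s.card)
    (hopt : ∀ τ : V → ℕ, Set.InjOn τ s → (∀ u ∈ s, τ u < s.card) →
        distEnergy (fun u v => kiteDist (τ u) (τ v)) s x ≤
          distEnergy (fun u v => kiteDist (σ u) (σ v)) s x) (hs : 5 ≤ s.card)
    {w b : V} (hw : w ∈ s) (hb : b ∈ s) (hwb : w ≠ b) (hσw : σ w ≤ 2) (hσb : σ b ≤ 2)
    (hR : ∑ u ∈ s with ¬ σ u ≤ 2, x u < x b) : x w ≤ ∑ u ∈ s with ¬ σ u ≤ 2, x u := by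
  obtain ⟨z, hz, hσz⟩ : ∃ z ∈ s, σ z = s.card - 1 := by
    have him : s.image σ = Finset.range s.card := by
      refine Finset.eq_of_subset_of_card_le ?_ ?_
      · intro i hi
        obtain ⟨u, hu, rfl⟩ := Finset.mem_image.1 hi
        exact Finset.mem_range.2 (hσ' u hu)
      · rw [Finset.card_image_of_injOn hσ, Finset.card_range]
    have : s.card - 1 ∈ s.image σ := by rw [him, Finset.mem_range]; omega
    simpa using this
  have hbz : b ≠ z := by rintro rfl; omega
  have hwz : w ≠ z := by rintro rfl; omega
  set R := ∑ u ∈ s with ¬ σ u ≤ 2, x u with hRdef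
  have hzR : x z ≤ R := Finset.single_le_sum (f := x)
    (fun u hu => (hx u (Finset.mem_filter.1 hu).1).le)
    (Finset.mem_filter.2 ⟨hz, by omega⟩)
  set T := (s.erase b).erase z with hT
  have hzT : z ∉ T := by simp [hT]
  have hbT : b ∉ insert z T := by simp [hT, hbz]
  have hsT : s = insert b (insert z T) := by
    rw [hT, Finset.insert_erase (by simp [hz, hbz.symm]), Finset.insert_erase hb]
  have hTs : ∀ u ∈ T, u ∈ s := fun u hu => by rw [hsT]; simp [hu]
  have hTb : ∀ u ∈ T, u ≠ b := by rintro u hu rfl; exact hbT (by simp [hu])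
  have hTz : ∀ u ∈ T, u ≠ z := by rintro u hu rfl; exact hzT hu
  have hswap : ∀ u ∈ s, Equiv.swap b z u ∈ s := by
    intro u hu
    rw [Equiv.swap_apply_def]
    split_ifs <;> assumption
  -- Exchanging `b` with the vertex `z` at the far end cannot raise the energy. Since `z` is lighter
  -- than `b`, this forces `hD`: the weighted distance sum over `T` from `z` is at most that from
  -- `b`.
  have hle := hopt (fun u => σ (Equiv.swap b z u))
    (fun u hu v hv huv => (Equiv.swap b z).injective (hσ (hswap u hu) (hswap v hv) huv))
    (fun u hu => hσ' _ (hswap u hu))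
  rw [hsT, distEnergy_insert (fun _ _ => kiteDist_comm _ _) (fun _ => kiteDist_self _) x hbT,
    distEnergy_insert (fun _ _ => kiteDist_comm _ _) (fun _ => kiteDist_self _) x hzT,
    distEnergy_insert (fun _ _ => kiteDist_comm _ _) (fun _ => kiteDist_self _) x hbT,
    distEnergy_insert (fun _ _ => kiteDist_comm _ _) (fun _ => kiteDist_self _) x hzT,
    Finset.sum_insert hzT, Finset.sum_insert hzT, Equiv.swap_apply_left,
    Equiv.swap_apply_right] at hle
  have hfix : ∀ u ∈ T, Equiv.swap b z u = u := fun u hu =>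
    Equiv.swap_apply_of_ne_of_ne (hTb u hu) (hTz u hu)
  have e1 : distEnergy (fun u v => kiteDist (σ (Equiv.swap b z u)) (σ (Equiv.swap b z v))) T x =
      distEnergy (fun u v => kiteDist (σ u) (σ v)) T x :=
    distEnergy_congr (fun u hu v hv => by rw [hfix u hu, hfix v hv]) fun _ _ => rfl
  have e2 : ∀ i, ∑ v ∈ T, (kiteDist i (σ (Equiv.swap b z v)) : ℝ) * x v =
      ∑ v ∈ T, (kiteDist i (σ v) : ℝ) * x v := fun i =>
    Finset.sum_congr rfl fun v hv => by rw [hfix v hv]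
  rw [e1, e2, e2, kiteDist_comm (σ z) (σ b)] at hle
  have hD : ∑ v ∈ T, (kiteDist (σ z) (σ v) : ℝ) * x v ≤
      ∑ v ∈ T, (kiteDist (σ b) (σ v) : ℝ) * x v := by
    have hpos : 0 < x b - x z := by linarith
    refine le_of_mul_le_mul_left ?_ hpos
    linarith
  have hwT : w ∈ T := by simp [hT, hw, hwz, hwb]
  have hRT : ∑ u ∈ T, (if ¬ σ u ≤ 2 then x u else 0) ≤ R := by
    rw [hRdef, Finset.sum_filter]
    refine Finset.sum_le_sum_of_subset_of_nonneg (fun u hu => hTs u hu) fun u hu _ => ?_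
    split_ifs
    · exact le_rfl
    · exact (hx u hu).le
  -- Passing from `b` to the far end adds `s.card - 4` to the distance of each remaining clique-end
  -- vertex, in particular `w`, and takes at most `s.card - 4` from a path vertex. With `hD`, the
  -- weight of `w` cannot exceed the path mass.
  have hcoef : ∑ v ∈ T, ((kiteDist (σ b) (σ v) : ℝ) * x v +
      ((s.card : ℝ) - 4) * ((if v = w then x v else 0) - (if ¬ σ v ≤ 2 then x v else 0))) ≤
      ∑ v ∈ T, (kiteDist (σ z) (σ v) : ℝ) * x v := by
    refine Finset.sum_le_sum fun v hv => ?_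
    have xv := (hx v (hTs v hv)).le
    have hvb : σ v ≠ σ b := fun h => hTb v hv (hσ (hTs v hv) hb h)
    have hvz : σ v ≠ σ z := fun h => hTz v hv (hσ (hTs v hv) hz h)
    have hvN := hσ' v (hTs v hv)
    by_cases h2 : σ v ≤ 2
    · simp only [h2, not_true, if_false, sub_zero]
      have h3 : kiteDist (σ b) (σ v) = 1 := by unfold kiteDist; split_ifs <;> omega
      have h4 : kiteDist (σ z) (σ v) + 3 = s.card := by unfold kiteDist; split_ifs <;> omega
      have h5 : (kiteDist (σ z) (σ v) : ℝ) = s.card - 3 := by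
        rw [← h4]; push_cast; ring
      rw [h3, h5]
      have h6 : (5 : ℝ) ≤ s.card := by exact_mod_cast hs
      split_ifs
      · push_cast; linarith
      · push_cast; nlinarith
    · have hvw : v ≠ w := by rintro rfl; omega
      simp only [h2, hvw, not_false_eq_true, if_true, if_false]
      have h3 : kiteDist (σ b) (σ v) + 4 ≤ kiteDist (σ z) (σ v) + s.card := by
        unfold kiteDist; split_ifs <;> omega
      have h4 : (kiteDist (σ b) (σ v) : ℝ) + 4 ≤ kiteDist (σ z) (σ v) + s.card := by
        exact_mod_cast h3
      have := mul_le_mul_of_nonneg_right h4 xv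
      linarith
  rw [Finset.sum_add_distrib, ← Finset.mul_sum, Finset.sum_sub_distrib,
    Finset.sum_ite_eq' T w x, if_pos hwT] at hcoef
  have h6 : (5 : ℝ) ≤ s.card := by exact_mod_cast hs
  by_contra! hcon
  have : 0 < ((s.card : ℝ) - 4) * (x w - ∑ u ∈ T, (if ¬ σ u ≤ 2 then x u else 0)) :=
    mul_pos (by linarith) (by linarith)
  linarith

theorem exists_placement_insert_left {V : Type*} [DecidableEq V] {s : Finset V} {x : V → ℝ}
    {l w : V} (hl : l ∉ s) (hw : w ∈ s) (hx : ∀ u ∈ insert l s, 0 < x u) {σ : V → ℕ}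
    (hσ : Set.InjOn σ s) (hσ' : ∀ u ∈ s, σ u < s.card) (hs : 5 ≤ s.card)
    (hmass : x l ≤ ∑ u ∈ s.erase w with ¬ σ u ≤ max (σ w) 2, x u) :
    ∃ τ : V → ℕ, Set.InjOn τ (insert l s : Finset V) ∧
      (∀ u ∈ insert l s, τ u < (insert l s).card) ∧
      distEnergy (fun u v => kiteDist (σ u) (σ v)) s (Function.update x w (x w + x l))
        + 2 * (x l * (x w + ∑ v ∈ s.erase w, x v)) ≤
      distEnergy (fun u v => kiteDist (τ u) (τ v)) (insert l s) x := by
  have hlw : l ≠ w := by rintro rfl; exact hl hw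
  -- If `w` is in the clique end it must move out to position 3, otherwise one step to the right: in
  -- both cases to `t + 1`, with everything beyond `t` shifted.
  obtain ⟨t, ht⟩ : ∃ t, t = max (σ w) 2 := ⟨_, rfl⟩
  rw [← ht] at hmass
  let τ : V → ℕ := fun u => if u = l then σ w else if u = w then t + 1 else
    if σ u ≤ t then σ u else σ u + 1
  have τl : τ l = σ w := by simp [τ]
  have τw : τ w = t + 1 := by simp [τ, hlw.symm]
  have τT : ∀ u ∈ s, u ≠ w → (σ u ≤ t ∧ τ u = σ u) ∨ (t < σ u ∧ τ u = σ u + 1) := by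
    intro u hu huw
    have hul : u ≠ l := by rintro rfl; exact hl hu
    by_cases h : σ u ≤ t
    · left; simp [τ, hul, huw, h]
    · right; simp [τ, hul, huw, h]; omega
  clear_value τ
  have ne : ∀ u ∈ s, u ≠ w → σ u ≠ σ w := fun u hu h h' => h (hσ hu hw h')
  have hwN := hσ' w hw
  refine ⟨τ, ?_, ?_, ?_⟩
  · intro u hu v hv huv
    simp only [Finset.coe_insert, Set.mem_insert_iff, Finset.mem_coe] at hu hv
    by_cases huw : u = w <;> by_cases hvw : v = w
    · rw [huw, hvw]
    · exfalso
      rcases hv with rfl | hv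
      · rw [huw] at huv; omega
      · have := τT v hv hvw
        rw [huw] at huv; omega
    · exfalso
      rcases hu with rfl | hu
      · rw [hvw] at huv; omega
      · have := τT u hu huw
        rw [hvw] at huv; omega
    · rcases hu with rfl | hu <;> rcases hv with rfl | hv
      · rfl
      · have := τT v hv hvw
        have := ne v hv hvw
        omega
      · have := τT u hu huw
        have := ne u hu huw
        omega
      · have := τT v hv hvw
        have := τT u hu huw
        exact hσ hu hv (by omega)
  · intro u hu
    rw [Finset.card_insert_of_notMem hl]
    rcases Finset.mem_insert.1 hu with rfl | hu
    · omega
    · by_cases huw : u = w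
      · subst huw; omega
      · have := τT u hu huw
        have := hσ' u hu
        omega
  · have hsT : s = insert w (s.erase w) := (Finset.insert_erase hw).symm
    have hmem : ∀ u ∈ s.erase w, u ∈ s ∧ u ≠ w := fun u hu =>
      ⟨Finset.mem_of_mem_erase hu, Finset.ne_of_mem_erase hu⟩
    have key := energy_insert_left (δ := fun u v => kiteDist (σ u) (σ v))
      (ε := fun u v => kiteDist (τ u) (τ v)) (T := s.erase w) (x := x) (l := l) (w := w)
      (fun u => σ u ≤ t) (by simp) (by rwa [← hsT]) (by rw [← hsT]; exact fun u hu => (hx u hu).le)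
      (fun _ _ => kiteDist_comm _ _) (fun _ _ => kiteDist_comm _ _)
      (fun _ => kiteDist_self _) (fun _ => kiteDist_self _) ?_ ?_ ?_ ?_ ?_ ?_ hmass
    · rwa [← hsT] at key
    · intro u hu v hv
      obtain ⟨hu, huw⟩ := hmem u hu
      obtain ⟨hv, hvw⟩ := hmem v hv
      have := τT v hv hvw
      have := τT u hu huw
      simp only [kiteDist]
      split_ifs <;> omega
    · intro u hu v hv pu pv
      obtain ⟨hu, huw⟩ := hmem u hu
      obtain ⟨hv, hvw⟩ := hmem v hv
      have := τT v hv hvw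
      have := τT u hu huw
      simp only [kiteDist]
      split_ifs <;> omega
    · intro v hv
      obtain ⟨hv, hvw⟩ := hmem v hv
      have := τT v hv hvw
      simp only [kiteDist, τw]
      split_ifs <;> omega
    · intro v hv
      obtain ⟨hv, hvw⟩ := hmem v hv
      have := τT v hv hvw
      simp only [kiteDist, τl]
      split_ifs <;> omega
    · intro v hv pv
      obtain ⟨hv, hvw⟩ := hmem v hv
      have := τT v hv hvw
      simp only [kiteDist, τl]
      split_ifs <;> omega
    · simp only [kiteDist, τl, τw]
      split_ifs <;> omega

/-- The hypothesis `3 ≤ σ w` is essential to this move: only for `w` on the path does the position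
after `w` lie one step farther from everything on its left. -/
theorem exists_placement_insert_right {V : Type*} [DecidableEq V] {s : Finset V} {x : V → ℝ}
    {l w : V} (hl : l ∉ s) (hw : w ∈ s) (hx : ∀ u ∈ insert l s, 0 < x u) {σ : V → ℕ}
    (hσ : Set.InjOn σ s) (hσ' : ∀ u ∈ s, σ u < s.card) (hσw : 3 ≤ σ w)
    (hmass : x l ≤ x w + ∑ u ∈ s.erase w with σ u ≤ σ w, x u) :
    ∃ τ : V → ℕ, Set.InjOn τ (insert l s : Finset V) ∧
      (∀ u ∈ insert l s, τ u < (insert l s).card) ∧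
      distEnergy (fun u v => kiteDist (σ u) (σ v)) s (Function.update x w (x w + x l))
        + 2 * (x l * (x w + ∑ v ∈ s.erase w, x v)) ≤
      distEnergy (fun u v => kiteDist (τ u) (τ v)) (insert l s) x := by
  have hlw : l ≠ w := by rintro rfl; exact hl hw
  let τ : V → ℕ := fun u => if u = l then σ w + 1 else if σ u ≤ σ w then σ u else σ u + 1
  have τl : τ l = σ w + 1 := by simp [τ]
  have τw : τ w = σ w := by simp [τ, hlw.symm]
  have τT : ∀ u ∈ s, (σ u ≤ σ w ∧ τ u = σ u) ∨ (σ w < σ u ∧ τ u = σ u + 1) := by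
    intro u hu
    have hul : u ≠ l := by rintro rfl; exact hl hu
    by_cases h : σ u ≤ σ w
    · left; simp [τ, hul, h]
    · right; simp [τ, hul, h]; omega
  clear_value τ
  have ne : ∀ u ∈ s, u ≠ w → σ u ≠ σ w := fun u hu h h' => h (hσ hu hw h')
  have hwN := hσ' w hw
  refine ⟨τ, ?_, ?_, ?_⟩
  · intro u hu v hv huv
    simp only [Finset.coe_insert, Set.mem_insert_iff, Finset.mem_coe] at hu hv
    rcases hu with rfl | hu <;> rcases hv with rfl | hv
    · rfl
    · have := τT v hv
      omega
    · have := τT u hu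
      omega
    · have := τT v hv
      have := τT u hu
      exact hσ hu hv (by omega)
  · intro u hu
    rw [Finset.card_insert_of_notMem hl]
    rcases Finset.mem_insert.1 hu with rfl | hu
    · omega
    · have := τT u hu
      have := hσ' u hu
      omega
  · have hsT : s = insert w (s.erase w) := (Finset.insert_erase hw).symm
    have hmem : ∀ u ∈ s.erase w, u ∈ s ∧ u ≠ w := fun u hu =>
      ⟨Finset.mem_of_mem_erase hu, Finset.ne_of_mem_erase hu⟩
    have key := energy_insert_right (δ := fun u v => kiteDist (σ u) (σ v))
      (ε := fun u v => kiteDist (τ u) (τ v)) (T := s.erase w) (x := x) (l := l) (w := w)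
      (fun u => σ u ≤ σ w) (by simp) (by rwa [← hsT])
      (by rw [← hsT]; exact fun u hu => (hx u hu).le)
      (fun _ _ => kiteDist_comm _ _) (fun _ _ => kiteDist_comm _ _)
      (fun _ => kiteDist_self _) (fun _ => kiteDist_self _) ?_ ?_ ?_ ?_ ?_ ?_ ?_ hmass
    · rwa [← hsT] at key
    · intro u hu v hv
      have := τT v (hmem v hv).1
      have := τT u (hmem u hu).1
      simp only [kiteDist]
      split_ifs <;> omega
    · intro u hu v hv pu pv
      have := τT v (hmem v hv).1
      have := τT u (hmem u hu).1
      simp only [kiteDist]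
      split_ifs <;> omega
    · intro v hv
      have := τT v (hmem v hv).1
      simp only [kiteDist, τw]
      split_ifs <;> omega
    · intro v hv pv
      have := τT v (hmem v hv).1
      simp only [kiteDist, τw]
      split_ifs <;> omega
    · intro v hv
      have := τT v (hmem v hv).1
      have := ne v (hmem v hv).1 (hmem v hv).2
      simp only [kiteDist, τl]
      split_ifs <;> omega
    · intro v hv pv
      have := τT v (hmem v hv).1
      have := ne v (hmem v hv).1 (hmem v hv).2
      simp only [kiteDist, τl]
      split_ifs <;> omega
    · simp only [kiteDist, τl, τw]
      split_ifs <;> omega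

/-- The good placement of the merged weighting `y` is improved to an optimal one. If `m` lies to the
right of `w`, then `l` takes the place of `w`; if `m` does not and `w` is on the path, `l` goes to
the right of `w`. Either way `m` provides the mass that the move requires. -/
theorem KiteDominated.exists_insert {V : Type*} [DecidableEq V] {d : V → V → ℕ}
    (hs : ∀ u v, d u v = d v u) (h0 : ∀ u, d u u = 0) {s : Finset V} (h : KiteDominated d s)
    (hcard : 5 ≤ s.card) {l w m : V} (hl : l ∉ s) (hw : w ∈ s) (hm : m ∈ s) (hmw : m ≠ w)
    (hd : ∀ v, d l v ≤ d w v + 1) {x : V → ℝ} (hx : ∀ u ∈ insert l s, 0 < x u)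
    (hlm : x l ≤ x m) :
    ∃ τ : V → ℕ, Set.InjOn τ (insert l s : Finset V) ∧
      (∀ u ∈ insert l s, τ u < (insert l s).card) ∧
      distEnergy d (insert l s) x <
        distEnergy (fun u v => kiteDist (τ u) (τ v)) (insert l s) x := by
  have hsT : s = insert w (s.erase w) := (Finset.insert_erase hw).symm
  have xs : ∀ u ∈ s, 0 < x u := fun u hu => hx u (by simp [hu])
  have xl := hx l (by simp)
  set y := Function.update x w (x w + x l) with hy
  have yw : y w = x w + x l := by simp [hy]
  have yne : ∀ u, u ≠ w → y u = x u := fun u hu => by simp [hy, hu]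
  have ypos : ∀ u ∈ s, 0 < y u := by
    intro u hu
    by_cases huw : u = w
    · rw [huw, yw]; linarith [xs w hw]
    · rw [yne u huw]; exact xs u hu
  obtain ⟨σ₀, i₀, j₀, k₀⟩ := h y ypos
  obtain ⟨σ, hσ, hσ', hopt⟩ := exists_optimal_placement (x := y) i₀ j₀
  have hlt := k₀.trans_le (hopt σ₀ i₀ j₀)
  have hup : distEnergy d (insert l s) x ≤
      distEnergy d s y + 2 * (x l * (x w + ∑ v ∈ s.erase w, x v)) := by
    have := distEnergy_insert_le_merge hs h0 (x := x) (l := l) (w := w) (T := s.erase w)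
      (by simp) (by rwa [← hsT]) (by rw [← hsT]; exact fun u hu => (hx u hu).le) hd
    rwa [← hsT] at this
  suffices H : ∃ τ : V → ℕ, Set.InjOn τ (insert l s : Finset V) ∧
      (∀ u ∈ insert l s, τ u < (insert l s).card) ∧
      distEnergy (fun u v => kiteDist (σ u) (σ v)) s y
        + 2 * (x l * (x w + ∑ v ∈ s.erase w, x v)) ≤
      distEnergy (fun u v => kiteDist (τ u) (τ v)) (insert l s) x by
    obtain ⟨τ, i, j, k⟩ := H
    exact ⟨τ, i, j, by linarith⟩
  have hmT : m ∈ s.erase w := by simp [hm, hmw]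
  have nonneg : ∀ p : V → Prop, ∀ _ : DecidablePred p, ∀ u ∈ (s.erase w).filter p, 0 ≤ x u :=
    fun p _ u hu => (xs u (Finset.mem_of_mem_erase (Finset.mem_filter.1 hu).1)).le
  by_cases hpos : σ m ≤ max (σ w) 2
  · by_cases hw3 : 3 ≤ σ w
    · refine exists_placement_insert_right hl hw hx hσ hσ' hw3 ?_
      have : x m ≤ ∑ u ∈ s.erase w with σ u ≤ σ w, x u :=
        Finset.single_le_sum (nonneg _ _) (Finset.mem_filter.2 ⟨hmT, by omega⟩)
      linarith [xs w hw]
    · refine exists_placement_insert_left hl hw hx hσ hσ' hcard ?_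
      have hmax : max (σ w) 2 = 2 := by omega
      rw [hmax] at hpos ⊢
      have hsum : ∑ u ∈ s.erase w with ¬ σ u ≤ 2, x u = ∑ u ∈ s with ¬ σ u ≤ 2, y u := by
        have : (s.erase w).filter (fun u => ¬ σ u ≤ 2) = s.filter (fun u => ¬ σ u ≤ 2) := by
          ext u
          simp only [Finset.mem_filter, Finset.mem_erase]
          constructor
          · tauto
          · rintro ⟨hu, h2⟩
            exact ⟨⟨by rintro rfl; omega, hu⟩, h2⟩
        rw [this]
        refine Finset.sum_congr rfl fun u hu => (yne u ?_).symm
        rintro rfl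
        exact (Finset.mem_filter.1 hu).2 (by omega)
      rw [hsum]
      -- Both `w` and `m` are in the clique end. If the path mass were below `x l`, it would be
      -- below `y m`, and optimality would give `y w` at most that mass, although `y w = x w + x l`.
      by_contra hcon
      rw [not_le] at hcon
      have := le_mass_of_optimal ypos hσ hσ' hopt hcard hw hm hmw.symm (by omega) hpos
        (by rw [yne m hmw]; linarith)
      rw [yw] at this
      linarith [xs w hw]
  · refine exists_placement_insert_left hl hw hx hσ hσ' hcard ?_
    refine hlm.trans (Finset.single_le_sum (nonneg _ _) (Finset.mem_filter.2 ⟨hmT, hpos⟩))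

/-! ### Induction on rooted trees -/

/-- A tree rooted at `r`, given by its parent function, whose distance is at least `d`. -/
structure IsRootedTree {V : Type*} (d : V → V → ℕ) (r : V) (par : V → V) (dep : V → ℕ) :
    Prop where
  symm : ∀ u v, d u v = d v u
  self : ∀ u, d u u = 0
  step : ∀ u, u ≠ r → ∀ v, d u v ≤ d (par u) v + 1
  dep_root : dep r = 0
  dep_par : ∀ u, u ≠ r → dep u = dep (par u) + 1

namespace IsRootedTree

variable {V : Type*} {d : V → V → ℕ} {r : V} {par : V → V} {dep : V → ℕ}

theorem ne_root (h : IsRootedTree d r par dep) {u : V} (hu : 1 ≤ dep u) : u ≠ r := by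
  rintro rfl
  have := h.dep_root
  omega

theorem eq_root (h : IsRootedTree d r par dep) {u : V} (hu : dep u = 0) : u = r := by
  by_contra hne
  have := h.dep_par u hne
  omega

theorem par_eq_root (h : IsRootedTree d r par dep) {u : V} (hu : dep u = 1) : par u = r := by
  have := h.dep_par u (h.ne_root hu.ge)
  exact h.eq_root (by omega)

theorem dist_root_le (h : IsRootedTree d r par dep) (n : ℕ) :
    ∀ u, dep u = n → d r u ≤ n := by
  induction n with
  | zero => intro u hu; rw [h.eq_root hu, h.self]
  | succ n ih =>
    intro u hu
    have hne := h.ne_root (u := u) (by omega)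
    have h1 := h.dep_par u hne
    have h2 := h.step u hne r
    have h3 := ih (par u) (by omega)
    rw [h.symm] at h3 ⊢
    omega

theorem dist_le_of_dep_one (h : IsRootedTree d r par dep) {u : V} (hu : dep u = 1) (v : V) :
    d u v ≤ dep v + 1 := by
  have h1 := h.step u (h.ne_root hu.ge) v
  rw [h.par_eq_root hu] at h1
  have := h.dist_root_le _ v rfl
  omega

variable [DecidableEq V]

/-- The lighter of the two leaves is the one removed, and the other serves as `m` in
`KiteDominated.exists_insert`. Which one is lighter depends on the weighting, so domination is
needed after either removal. -/
theorem kiteDominated_step (h : IsRootedTree d r par dep) {s : Finset V}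
    (hclosed : ∀ u ∈ s, u ≠ r → par u ∈ s) (hs : 8 ≤ s.card) {l m : V} (hl : l ∈ s) (hm : m ∈ s)
    (hlr : l ≠ r) (hmr : m ≠ r) (hlm : l ≠ m) (hl' : ∀ u ∈ s, u ≠ r → par u ≠ l)
    (hm' : ∀ u ∈ s, u ≠ r → par u ≠ m) (ihl : KiteDominated d (s.erase l))
    (ihm : KiteDominated d (s.erase m)) : KiteDominated d s := by
  have main : ∀ l ∈ s, ∀ m ∈ s, l ≠ r → m ≠ l → (∀ u ∈ s, u ≠ r → par u ≠ l) →
      (∀ u ∈ s, u ≠ r → par u ≠ m) → KiteDominated d (s.erase l) → ∀ x : V → ℝ,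
      (∀ u ∈ s, 0 < x u) → x l ≤ x m → ∃ σ : V → ℕ, Set.InjOn σ s ∧ (∀ u ∈ s, σ u < s.card) ∧
        distEnergy d s x < distEnergy (fun u v => kiteDist (σ u) (σ v)) s x := by
    intro l hl m hm hlr hml hl' hm' ih x hx hle
    have hins : insert l (s.erase l) = s := Finset.insert_erase hl
    have := ih.exists_insert h.symm h.self (l := l) (w := par l) (m := m) (x := x)
      (by rw [Finset.card_erase_of_mem hl]; omega) (by simp)
      (Finset.mem_erase.2 ⟨hl' l hl hlr, hclosed l hl hlr⟩) (Finset.mem_erase.2 ⟨hml, hm⟩)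
      (hm' l hl hlr).symm (h.step l hlr) (by rwa [hins]) hle
    rwa [hins] at this
  intro x hx
  rcases le_total (x l) (x m) with hle | hle
  · exact main l hl m hm hlr hlm.symm hl' hm' ihl x hx hle
  · exact main m hm l hl hmr hlm hm' hl' ihm x hx hle

/-- Such a tree is a broom: the vertices of depth at least 2 form one path, which continues through
a single child `p` of the root, and the other four children are leaves. Order at least 7 gives the
path including `p` at least two vertices, as the broom inequality requires. -/
theorem kiteDominated_of_chain (h : IsRootedTree d r par dep) {s : Finset V} (hr : r ∈ s)
    (hclosed : ∀ u ∈ s, u ≠ r → par u ∈ s) (hs : 7 ≤ s.card)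
    (hN : (s.filter fun u => dep u = 1).card = 5)
    (hinj : Set.InjOn dep (s.filter fun u => 2 ≤ dep u)) : KiteDominated d s := by
  intro x hx
  set N := s.filter fun u => dep u = 1 with hNdef
  set Q := s.filter fun u => 2 ≤ dep u with hQdef
  have memN : ∀ u, u ∈ N ↔ u ∈ s ∧ dep u = 1 := fun u => by simp [hNdef]
  have memQ : ∀ u, u ∈ Q ↔ u ∈ s ∧ 2 ≤ dep u := fun u => by simp [hQdef]
  have hrN : r ∉ N := by rw [memN, h.dep_root]; simp
  have hdisj : Disjoint (insert r N) Q := by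
    rw [Finset.disjoint_left]
    intro u hu hu'
    have hu2 := ((memQ u).1 hu').2
    rcases Finset.mem_insert.1 hu with rfl | hu
    · rw [h.dep_root] at hu2; omega
    · have := ((memN u).1 hu).2; omega
  have hsNQ : s = insert r N ∪ Q := by
    ext u
    simp only [Finset.mem_union, Finset.mem_insert, memN, memQ]
    constructor
    · intro hu
      by_cases hur : u = r
      · simp [hur]
      · have := h.dep_par u hur
        by_cases h1 : dep u = 1
        · simp [hu, h1]
        · exact Or.inr ⟨hu, by omega⟩
    · rintro ((rfl | hu) | hu)
      · exact hr
      · exact hu.1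
      · exact hu.1
  have hcard : s.card = 6 + Q.card := by
    conv_lhs => rw [hsNQ, Finset.card_union_of_disjoint hdisj, Finset.card_insert_of_notMem hrN, hN]
  obtain ⟨q, hq, hqmin⟩ := Q.exists_min_image dep (Finset.card_pos.1 (by omega))
  have hqs := ((memQ q).1 hq).1
  have hq2 := ((memQ q).1 hq).2
  have hqr := h.ne_root (u := q) (by omega)
  have hqdep : dep q = 2 := by
    by_contra hne
    have h1 := h.dep_par q hqr
    have := hqmin (par q) ((memQ _).2 ⟨hclosed q hqs hqr, by omega⟩)
    omega
  obtain ⟨p, hp⟩ : ∃ p, p = par q := ⟨_, rfl⟩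
  have hpdep : dep p = 1 := by have := h.dep_par q hqr; rw [hp]; omega
  have hpN : p ∈ N := (memN p).2 ⟨hp ▸ hclosed q hqs hqr, hpdep⟩
  have hpQ : p ∉ Q := fun hh => by have := ((memQ p).1 hh).2; omega
  have hparP : ∀ u ∈ Q, par u ∈ insert p Q := by
    intro u hu
    have hu2 := ((memQ u).1 hu).2
    have hur := h.ne_root (u := u) (by omega)
    have h1 := h.dep_par u hur
    by_cases h2 : dep u = 2
    · have : u = q := hinj hu hq (by omega)
      simp [this, hp]
    · exact Finset.mem_insert_of_mem
        ((memQ _).2 ⟨hclosed u ((memQ u).1 hu).1 hur, by omega⟩)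
  have hPdep : ∀ u ∈ insert p Q, u = p ∧ dep u = 1 ∨ u ∈ Q ∧ 2 ≤ dep u := by
    intro u hu
    rcases Finset.mem_insert.1 hu with rfl | hu
    · exact Or.inl ⟨rfl, hpdep⟩
    · exact Or.inr ⟨hu, ((memQ u).1 hu).2⟩
  have hinjP : Set.InjOn dep (insert p Q : Finset V) := by
    intro u hu v hv huv
    rcases hPdep u hu with ⟨rfl, h1⟩ | ⟨hu, h1⟩ <;> rcases hPdep v hv with ⟨rfl, h2⟩ | ⟨hv, h2⟩
    · rfl
    · omega
    · omega
    · exact hinj hu hv huv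
  -- Depths on the path have no gaps, so each is bounded by the number of path vertices.
  have hattained : ∀ n, ∀ u ∈ insert p Q, dep u = n →
      Finset.Icc 1 n ⊆ (insert p Q).image dep := by
    intro n
    induction n with
    | zero => intro u _ _; simp
    | succ n ih =>
      intro u hu hun i hi
      by_cases hin : i = n + 1
      · exact Finset.mem_image.2 ⟨u, hu, by omega⟩
      · rw [Finset.mem_Icc] at hi
        rcases hPdep u hu with ⟨rfl, h1⟩ | ⟨hu, h1⟩
        · omega
        · have := h.dep_par u (h.ne_root (by omega))
          exact ih (par u) (hparP u hu) (by omega) (Finset.mem_Icc.2 (by omega))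
  have hpath : ∀ n, ∀ v ∈ insert p Q, dep v = n → ∀ u ∈ insert p Q, dep u ≤ dep v →
      d u v ≤ dep v - dep u := by
    intro n
    induction n with
    | zero =>
      intro v hv hvn
      rcases hPdep v hv with ⟨rfl, h1⟩ | ⟨hv, h1⟩ <;> omega
    | succ n ih =>
      intro v hv hvn u hu huv
      by_cases heq : dep u = dep v
      · rw [hinjP hu hv heq, h.self]; omega
      · have hu1 : 1 ≤ dep u := by rcases hPdep u hu with ⟨rfl, h1⟩ | ⟨hu, h1⟩ <;> omega
        rcases hPdep v hv with ⟨rfl, h1⟩ | ⟨hv, h1⟩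
        · omega
        · have hvr := h.ne_root (u := v) (by omega)
          have h2 := h.dep_par v hvr
          have h3 := ih (par v) (hparP v hv) (by omega) u hu (by omega)
          have h4 := h.step v hvr u
          rw [h.symm] at h3 ⊢
          omega
  have hrP : r ∉ insert p Q := fun hh => by
    have := h.dep_root
    rcases hPdep r hh with ⟨_, h1⟩ | ⟨_, h1⟩ <;> omega
  have mk : ∀ a b c e : V, a ≠ b → a ≠ c → a ≠ e → b ≠ c → b ≠ e → c ≠ e →
      N.erase p = {a, b, c, e} → IsBroom d s (insert p Q) dep a b c e r := by
    intro a b c e hab hac hae hbc hbe hce hF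
    have leaf : ∀ l, (l = a ∨ l = b ∨ l = c ∨ l = e) → dep l = 1 ∧ l ≠ r ∧ l ≠ p ∧ l ∉ Q := by
      intro l hl
      have hlF : l ∈ N.erase p := by rw [hF]; simpa using hl
      rw [Finset.mem_erase, memN] at hlF
      refine ⟨hlF.2.2, h.ne_root hlF.2.2.ge, hlF.1, fun hh => ?_⟩
      have := ((memQ l).1 hh).2
      omega
    obtain ⟨-, ha1, ha2, ha3⟩ := leaf a (by simp)
    obtain ⟨-, hb1, hb2, hb3⟩ := leaf b (by simp)
    obtain ⟨-, hc1, hc2, hc3⟩ := leaf c (by simp)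
    obtain ⟨-, he1, he2, he3⟩ := leaf e (by simp)
    refine ⟨h.symm, h.self, ?_, by simp [hab, hac, hae, ha1, ha2, ha3],
      by simp [hbc, hbe, hb1, hb2, hb3], by simp [hce, hc1, hc2, hc3], by simp [he1, he2, he3],
      hrP, hinjP, ?_, ?_, ?_, ?_, ?_, ?_, ?_⟩
    · rw [hsNQ, ← Finset.insert_erase hpN, hF]
      ext u
      simp only [Finset.mem_union, Finset.mem_insert, Finset.mem_singleton, or_assoc,
        or_left_comm]
    · intro u hu
      rcases hPdep u hu with ⟨rfl, h1⟩ | ⟨hu, h1⟩ <;> omega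
    · intro u hu
      have := Finset.card_le_card (hattained _ u hu rfl)
      rw [Nat.card_Icc, Finset.card_image_of_injOn hinjP] at this
      omega
    · intro u hu v hv huv
      exact hpath _ v hv rfl u hu huv
    · intro u _
      exact h.dist_root_le _ u rfl
    · intro l hl u _
      exact h.dist_le_of_dep_one (leaf l hl).1 u
    · intro l hl
      have := h.dist_le_of_dep_one (leaf l hl).1 r
      rwa [h.dep_root] at this
    · intro l hl m hm
      have := h.dist_le_of_dep_one (leaf l hl).1 m
      rwa [(leaf m hm).1] at this
  have hF4 : (N.erase p).card = 4 := by rw [Finset.card_erase_of_mem hpN, hN]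
  obtain ⟨a, haF, ha⟩ := (N.erase p).exists_max_image x (Finset.card_pos.1 (by omega))
  have hF3 : ((N.erase p).erase a).card = 3 := by rw [Finset.card_erase_of_mem haF, hF4]
  obtain ⟨e, heF, he⟩ :=
    ((N.erase p).erase a).exists_min_image x (Finset.card_pos.1 (by omega))
  have hF2 : (((N.erase p).erase a).erase e).card = 2 := by
    rw [Finset.card_erase_of_mem heF, hF3]
  obtain ⟨b, c, hbc, hF⟩ := Finset.card_eq_two.1 hF2
  have hb : b ∈ ((N.erase p).erase a).erase e := by rw [hF]; simp
  have hc : c ∈ ((N.erase p).erase a).erase e := by rw [hF]; simp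
  have heq : N.erase p = {a, e, b, c} := by
    rw [← Finset.insert_erase haF, ← Finset.insert_erase heF, hF]
  have hb1 := Finset.mem_erase.1 hb
  have hc1 := Finset.mem_erase.1 hc
  have hb2 := Finset.mem_erase.1 hb1.2
  have hc2 := Finset.mem_erase.1 hc1.2
  have he2 := Finset.mem_erase.1 heF
  refine kiteDominated_of_broom (P := insert p Q) (dep := dep) (a := a) (b := b) (c := c)
    (e := e) (r := r) ?_ ?_ ?_ hx (ha b hb2.2) (ha c hc2.2) (he b hb1.2) (he c hc1.2)
  · rw [Finset.card_insert_of_notMem hpQ]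
    have := Finset.card_pos.2 ⟨q, hq⟩
    omega
  · refine mk a b c e hb2.1.symm hc2.1.symm he2.1.symm hbc hb1.1 hc1.1 ?_
    rw [heq]; ext u; simp only [Finset.mem_insert, Finset.mem_singleton, or_comm, or_left_comm]
  · refine mk e b c a hb1.1.symm hc1.1.symm he2.1 hbc hb2.1 hc2.1 ?_
    rw [heq]; ext u; simp only [Finset.mem_insert, Finset.mem_singleton, or_comm, or_left_comm]

/-- Take two vertices of equal depth at least 2, as deep as possible. If both had children, the
children would be a deeper such pair. So one is a leaf; being the unique deep leaf, it has maximal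
depth. Then the other has maximal depth too and is a second deep leaf. -/
theorem injOn_of_unique_deep_leaf (h : IsRootedTree d r par dep) {s : Finset V}
    (huniq : ∀ l ∈ s, ∀ m ∈ s, 2 ≤ dep l → 2 ≤ dep m → (∀ u ∈ s, u ≠ r → par u ≠ l) →
      (∀ u ∈ s, u ≠ r → par u ≠ m) → l = m) :
    Set.InjOn dep (s.filter fun u => 2 ≤ dep u) := by
  have hne : ∀ u, 2 ≤ dep u → u ≠ r := fun u hu => h.ne_root (by omega)
  by_contra hcon
  simp only [Set.InjOn, not_forall, Finset.coe_filter, Set.mem_ofPred_eq] at hcon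
  obtain ⟨u₀, ⟨hu₀, hu₀'⟩, v₀, ⟨hv₀, hv₀'⟩, huv₀, hne₀⟩ := hcon
  obtain ⟨u, hu, humax⟩ := (s.filter fun u => 2 ≤ dep u ∧ ∃ v ∈ s, v ≠ u ∧ dep v = dep u)
    |>.exists_max_image dep
      ⟨u₀, Finset.mem_filter.2 ⟨hu₀, hu₀', v₀, hv₀, Ne.symm hne₀, huv₀.symm⟩⟩
  obtain ⟨hus, hu2, v, hvs, hvu, hdep⟩ := Finset.mem_filter.1 hu
  have nochild : ∀ a ∈ s, ∀ b ∈ s, 2 ≤ dep a → dep b = dep a → b ≠ a → dep a = dep u →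
      ¬ ((∃ c ∈ s, c ≠ r ∧ par c = a) ∧ ∃ c ∈ s, c ≠ r ∧ par c = b) := by
    rintro a ha b hb ha2 hab hne' hau ⟨⟨c, hc, hcr, rfl⟩, ⟨c', hc', hcr', rfl⟩⟩
    have h1 := h.dep_par c hcr
    have h2 := h.dep_par c' hcr'
    have := humax c (Finset.mem_filter.2 ⟨hc, by omega, c', hc', by
      rintro rfl; exact hne' rfl, by omega⟩)
    omega
  have oneleaf : ∀ a ∈ s, ∀ b ∈ s, 2 ≤ dep a → dep b = dep a → b ≠ a → dep a = dep u →
      (∀ c ∈ s, c ≠ r → par c ≠ a) → False := by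
    intro a ha b hb ha2 hab hne' hau hleaf
    obtain ⟨t, ht, htmax⟩ := s.exists_max_image dep ⟨a, ha⟩
    have htleaf : ∀ c ∈ s, c ≠ r → par c ≠ t := by
      rintro c hc hcr rfl
      have := h.dep_par c hcr
      have := htmax c hc
      omega
    have hta := huniq a ha t ht ha2 (by have := htmax a ha; omega) hleaf htleaf
    refine hne' (huniq b hb a ha (by omega) ha2 ?_ hleaf)
    rintro c hc hcr rfl
    have := h.dep_par c hcr
    have := htmax c hc
    rw [← hta] at this
    omega
  by_cases hlu : ∀ c ∈ s, c ≠ r → par c ≠ u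
  · exact oneleaf u hus v hvs hu2 hdep hvu rfl hlu
  · by_cases hlv : ∀ c ∈ s, c ≠ r → par c ≠ v
    · exact oneleaf v hvs u hus (by omega) hdep.symm hvu.symm hdep hlv
    · push Not at hlu hlv
      exact nochild u hus v hvs hu2 hdep hvu rfl ⟨hlu, hlv⟩

/-- All vertices of depth 1 share the parent `r`, so the parent map misses at least as many vertices
as there are of depth 1. -/
theorem exists_two_leaves (h : IsRootedTree d r par dep) {s : Finset V} (hr : r ∈ s)
    (hN : 3 ≤ (s.filter fun u => dep u = 1).card) :
    ∃ l ∈ s, ∃ m ∈ s, l ≠ r ∧ m ≠ r ∧ l ≠ m ∧ (∀ u ∈ s, u ≠ r → par u ≠ l) ∧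
      (∀ u ∈ s, u ≠ r → par u ≠ m) := by
  set N := s.filter fun u => dep u = 1 with hNdef
  have hNs : N ⊆ s.erase r := by
    intro u hu
    have := Finset.mem_filter.1 hu
    exact Finset.mem_erase.2 ⟨h.ne_root this.2.ge, this.1⟩
  set I := (s.erase r).image par with hI
  have hIsub : I ⊆ insert r ((s.erase r \ N).image par) := by
    intro v hv
    obtain ⟨u, hu, rfl⟩ := Finset.mem_image.1 hv
    by_cases huN : u ∈ N
    · rw [h.par_eq_root (Finset.mem_filter.1 huN).2]; simp
    · exact Finset.mem_insert_of_mem (Finset.mem_image_of_mem _ (Finset.mem_sdiff.2 ⟨hu, huN⟩))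
  have c1 : I.card ≤ (s.erase r \ N).card + 1 :=
    (Finset.card_le_card hIsub).trans ((Finset.card_insert_le _ _).trans
      (Nat.add_le_add_right Finset.card_image_le 1))
  have c2 := Finset.card_sdiff_add_card_eq_card hNs
  have c3 : (s.erase r).card + 1 = s.card := Finset.card_erase_add_one hr
  have c4 := Finset.le_card_sdiff I s
  obtain ⟨l, hl, m, hm, hlm⟩ := Finset.one_lt_card.1 (show 1 < (s \ I).card by omega)
  have hrI : r ∈ I := by
    obtain ⟨u, hu⟩ := Finset.card_pos.1 (show 0 < N.card by omega)
    exact Finset.mem_image.2 ⟨u, hNs hu, h.par_eq_root (Finset.mem_filter.1 hu).2⟩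
  have leaf : ∀ l ∈ s \ I, l ∈ s ∧ l ≠ r ∧ ∀ u ∈ s, u ≠ r → par u ≠ l := by
    intro l hl
    obtain ⟨hls, hlI⟩ := Finset.mem_sdiff.1 hl
    refine ⟨hls, by rintro rfl; exact hlI hrI, ?_⟩
    rintro u hu hur rfl
    exact hlI (Finset.mem_image_of_mem _ (Finset.mem_erase.2 ⟨hur, hu⟩))
  obtain ⟨l1, l2, l3⟩ := leaf l hl
  obtain ⟨m1, m2, m3⟩ := leaf m hm
  exact ⟨l, l1, m, m1, l2, m2, hlm, l3, m3⟩

/-- A removed leaf must leave five children at the root. With exactly five, only leaves of depth at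
least 2 may go, and if there are not two of them the tree is a broom. With six or more, any two
leaves will do. At order 7 only the broom and the star with six leaves remain. -/
theorem kiteDominated (h : IsRootedTree d r par dep) (n : ℕ) :
    ∀ s : Finset V, s.card = n + 7 → r ∈ s → (∀ u ∈ s, u ≠ r → par u ∈ s) →
      5 ≤ (s.filter fun u => dep u = 1).card → KiteDominated d s := by
  induction n with
  | zero =>
    intro s hs hr hclosed hN
    by_cases h5 : (s.filter fun u => dep u = 1).card = 5
    · refine h.kiteDominated_of_chain hr hclosed hs.ge h5 ?_
      refine h.injOn_of_unique_deep_leaf fun l hl m hm hl2 hm2 _ _ => ?_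
      by_contra hlm
      have hsub : insert r (insert l (insert m (s.filter fun u => dep u = 1))) ⊆ s := by
        intro u hu
        simp only [Finset.mem_insert, Finset.mem_filter] at hu
        rcases hu with rfl | rfl | rfl | hu
        · exact hr
        · exact hl
        · exact hm
        · exact hu.1
      have := Finset.card_le_card hsub
      rw [Finset.card_insert_of_notMem, Finset.card_insert_of_notMem,
        Finset.card_insert_of_notMem] at this
      · omega
      · simp; omega
      · simp [hlm]; omega
      · have h1 := h.ne_root (u := l) (by omega)
        have h2 := h.ne_root (u := m) (by omega)
        simp [h1.symm, h2.symm, h.dep_root]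
    · set N := s.filter fun u => dep u = 1 with hNdef
      have hrN : r ∉ N := by simp [hNdef, h.dep_root]
      have hsub : insert r N ⊆ s := Finset.insert_subset hr (Finset.filter_subset _ _)
      have hcard : (insert r N).card = N.card + 1 := Finset.card_insert_of_notMem hrN
      have hle := Finset.card_le_card hsub
      have hsN : insert r N = s := Finset.eq_of_subset_of_card_le hsub (by omega)
      rw [← hsN]
      have memN : ∀ u ∈ N, dep u = 1 := fun u hu => (Finset.mem_filter.1 hu).2
      refine kiteDominated_of_star h.symm h.self hrN ?_ ?_ (by omega)
      · intro u hu
        exact h.dist_root_le 1 u (memN u hu)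
      · intro u hu v hv
        have := h.dist_le_of_dep_one (memN u hu) v
        rwa [memN v hv] at this
  | succ n ih =>
    intro s hs hr hclosed hN
    have erase : ∀ l ∈ s, l ≠ r → (∀ u ∈ s, u ≠ r → par u ≠ l) →
        5 ≤ ((s.erase l).filter fun u => dep u = 1).card → KiteDominated d (s.erase l) := by
      intro l hl hlr hleaf hc
      refine ih _ (by rw [Finset.card_erase_of_mem hl]; omega)
        (Finset.mem_erase.2 ⟨hlr.symm, hr⟩) ?_ hc
      intro u hu hur
      have hu := Finset.mem_of_mem_erase hu
      exact Finset.mem_erase.2 ⟨hleaf u hu hur, hclosed u hu hur⟩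
    by_cases h5 : (s.filter fun u => dep u = 1).card = 5
    · by_cases huniq : ∀ l ∈ s, ∀ m ∈ s, 2 ≤ dep l → 2 ≤ dep m →
          (∀ u ∈ s, u ≠ r → par u ≠ l) → (∀ u ∈ s, u ≠ r → par u ≠ m) → l = m
      · exact h.kiteDominated_of_chain hr hclosed (by omega) h5
          (h.injOn_of_unique_deep_leaf huniq)
      · simp only [not_forall] at huniq
        obtain ⟨l, hl, m, hm, hl2, hm2, hl', hm', hlm⟩ := huniq
        have hlr := h.ne_root (u := l) (by omega)
        have hmr := h.ne_root (u := m) (by omega)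
        have deep : ∀ l, 2 ≤ dep l → 5 ≤ ((s.erase l).filter fun u => dep u = 1).card := by
          intro l hl2
          rw [Finset.filter_erase, Finset.erase_eq_of_notMem]
          · exact hN
          · simp; omega
        exact h.kiteDominated_step hclosed (by omega) hl hm hlr hmr hlm hl' hm'
          (erase l hl hlr hl' (deep l hl2)) (erase m hm hmr hm' (deep m hm2))
    · obtain ⟨l, hl, m, hm, hlr, hmr, hlm, hl', hm'⟩ := h.exists_two_leaves hr (by omega)
      have deg : ∀ l, 5 ≤ ((s.erase l).filter fun u => dep u = 1).card := by
        intro l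
        rw [Finset.filter_erase]
        have := Finset.pred_card_le_card_erase (s := s.filter fun u => dep u = 1) (a := l)
        omega
      exact h.kiteDominated_step hclosed (by omega) hl hm hlr hmr hlm hl' hm'
        (erase l hl hlr hl' (deg l)) (erase m hm hmr hm' (deg m))

end IsRootedTree

/-! ### Distances in the kite graph -/

/-- Truncated subtraction puts the labels 0, 1, 2 all on level 0 and label 3 on level 1, and
adjacent vertices differ by at most one level. Only this lower bound on the graph distance is
needed, since the kite energy is to be bounded from below. -/
theorem kiteDist_le_walk_length {n : ℕ} {i j : Fin n} (p : (kiteGraph 4 n).Walk i j) :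
    kiteDist i j ≤ p.length := by
  induction p with
  | nil => simp [kiteDist_self]
  | @cons u v w huv q ih =>
    rw [SimpleGraph.Walk.length_cons]
    refine le_trans ?_ (Nat.add_le_add_right ih 1)
    obtain ⟨hne, h⟩ := huv
    have hne' : (u : ℕ) ≠ v := fun hh => hne (Fin.ext hh)
    unfold kiteDist
    split_ifs <;> omega

theorem kiteGraph_connected {n : ℕ} (k : ℕ) (hn : 0 < n) : (kiteGraph k n).Connected := by
  have key : ∀ i, ∀ hi : i < n, (kiteGraph k n).Reachable ⟨0, hn⟩ ⟨i, hi⟩ := by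
    intro i
    induction i with
    | zero => intro hi; exact SimpleGraph.Reachable.refl _
    | succ i ih =>
      intro hi
      refine (ih (by omega)).trans (SimpleGraph.Adj.reachable ?_)
      refine ⟨fun hh => ?_, Or.inr (Or.inl rfl)⟩
      have := congrArg Fin.val hh
      simp at this
  have : Nonempty (Fin n) := ⟨⟨0, hn⟩⟩
  exact SimpleGraph.Connected.mk fun u v => (key u u.2).symm.trans (key v v.2)

theorem kiteDist_le_dist {n : ℕ} (i j : Fin n) : kiteDist i j ≤ (kiteGraph 4 n).dist i j := by
  obtain ⟨p, hp⟩ := (kiteGraph_connected 4 (Fin.pos i)).exists_walk_length_eq_dist i j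
  rw [← hp]
  exact kiteDist_le_walk_length p

/-! ### Breadth-first trees and the Rayleigh principle -/

namespace SimpleGraph

/-- The parent of `u` is the next vertex on a shortest path to `r`. -/
theorem Connected.exists_isRootedTree {V : Type*} {G : SimpleGraph V} (hG : G.Connected) (r : V) :
    ∃ par : V → V, IsRootedTree G.dist r par (G.dist r) := by
  have key : ∀ u, ∃ w, u ≠ r → G.Adj u w ∧ G.dist r u = G.dist r w + 1 := by
    intro u
    by_cases hu : u = r
    · exact ⟨u, fun h => absurd hu h⟩
    · obtain ⟨p, hp⟩ := hG.exists_walk_length_eq_dist u r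
      cases p with
      | nil => exact absurd rfl hu
      | @cons _ w _ huw q =>
        refine ⟨w, fun _ => ⟨huw, ?_⟩⟩
        rw [Walk.length_cons] at hp
        have h1 := G.dist_le q
        have h2 := hG.dist_triangle (u := u) (v := w) (w := r)
        rw [dist_eq_one_iff_adj.2 huw] at h2
        rw [G.dist_comm (u := r), G.dist_comm (u := r)]
        omega
  choose par hpar using key
  refine ⟨par, fun u v => G.dist_comm, fun u => G.dist_self, fun u hu v => ?_, G.dist_self,
    fun u hu => (hpar u hu).2⟩
  have h2 := hG.dist_triangle (u := u) (v := par u) (w := v)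
  rw [dist_eq_one_iff_adj.2 (hpar u hu).1] at h2
  omega

variable {V : Type*} [Fintype V] [DecidableEq V]

theorem posSemidef_distSpectralRadius_sub [Nonempty V] (G : SimpleGraph V) :
    (algebraMap ℝ (Matrix V V ℝ) G.distSpectralRadius - G.distMatrix).PosSemidef := by
  rw [Matrix.posSemidef_iff_isHermitian_and_spectrum_nonneg]
  refine ⟨?_, ?_⟩
  · refine Matrix.IsHermitian.sub ?_ G.distMatrix_isHermitian
    rw [Matrix.algebraMap_eq_diagonal]
    exact Matrix.isHermitian_diagonal _
  · rw [← spectrum.singleton_sub_eq]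
    rintro t ht
    obtain ⟨a, ha, b, hb, rfl⟩ := Set.mem_sub.1 ht
    rw [Set.mem_singleton_iff.1 ha]
    have := G.distSpectralRadius_isGreatest.2 hb
    simpa using this

theorem dotProduct_distSpectralRadius_sub (G : SimpleGraph V) (x : V → ℝ) :
    star x ⬝ᵥ ((algebraMap ℝ (Matrix V V ℝ) G.distSpectralRadius - G.distMatrix).mulVec x) =
      G.distSpectralRadius * ∑ u, x u ^ 2 - distEnergy G.dist Finset.univ x := by
  rw [Matrix.sub_mulVec, dotProduct_sub, Algebra.algebraMap_eq_smul_one, Matrix.smul_mulVec,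
    Matrix.one_mulVec]
  congr 1
  · simp only [dotProduct, star_trivial, Pi.smul_apply, smul_eq_mul, Finset.mul_sum]
    exact Finset.sum_congr rfl fun u _ => by ring
  · simp only [dotProduct, star_trivial, Matrix.mulVec, distMatrix, Matrix.of_apply, distEnergy,
      Finset.mul_sum]
    exact Finset.sum_congr rfl fun u _ => Finset.sum_congr rfl fun v _ => by ring

theorem distEnergy_le [Nonempty V] (G : SimpleGraph V) (x : V → ℝ) :
    distEnergy G.dist Finset.univ x ≤ G.distSpectralRadius * ∑ u, x u ^ 2 := by
  have := G.posSemidef_distSpectralRadius_sub.dotProduct_mulVec_nonneg x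
  rw [dotProduct_distSpectralRadius_sub] at this
  linarith

/-- The Perron vector of the distance matrix. -/
theorem Connected.exists_perron_vector {G : SimpleGraph V} (hG : G.Connected) [Nontrivial V] :
    ∃ x : V → ℝ, (∀ u, 0 < x u) ∧
      distEnergy G.dist Finset.univ x = G.distSpectralRadius * ∑ u, x u ^ 2 := by
  have hmem := G.distSpectralRadius_isGreatest.1
  rw [← Matrix.spectrum_toLin', ← Module.End.hasEigenvalue_iff_mem_spectrum] at hmem
  obtain ⟨v, hv⟩ := hmem.exists_hasEigenvector
  have hv0 : v ≠ 0 := hv.2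
  have hDv : G.distMatrix.mulVec v = G.distSpectralRadius • v := by
    simpa using hv.apply_eq_smul
  have hEv : distEnergy G.dist Finset.univ v = G.distSpectralRadius * ∑ u, v u ^ 2 := by
    have h1 := G.dotProduct_distSpectralRadius_sub v
    rw [Matrix.sub_mulVec, hDv, Algebra.algebraMap_eq_smul_one, Matrix.smul_mulVec,
      Matrix.one_mulVec, sub_self, dotProduct_zero] at h1
    linarith
  -- Absolute values do not lower the energy, as the distances are nonnegative, and they keep the
  -- norm; so `x` is again a maximiser, hence an eigenvector by semidefiniteness. A zero coordinate
  -- would force all others to vanish, because distances between distinct vertices are positive.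
  set x : V → ℝ := fun u => |v u| with hx
  have hEx : distEnergy G.dist Finset.univ x = G.distSpectralRadius * ∑ u, x u ^ 2 := by
    refine le_antisymm (G.distEnergy_le x) ?_
    have h1 : ∑ u, x u ^ 2 = ∑ u, v u ^ 2 := by simp [hx]
    rw [h1, ← hEv]
    refine Finset.sum_le_sum fun u _ => Finset.sum_le_sum fun w _ => ?_
    refine mul_le_mul_of_nonneg_left ?_ (Nat.cast_nonneg _)
    simp only [hx, ← abs_mul]
    exact le_abs_self _
  have hker := (G.posSemidef_distSpectralRadius_sub.dotProduct_mulVec_zero_iff x).1 (by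
    rw [dotProduct_distSpectralRadius_sub, hEx, sub_self])
  rw [Matrix.sub_mulVec, Algebra.algebraMap_eq_smul_one, Matrix.smul_mulVec,
    Matrix.one_mulVec, sub_eq_zero] at hker
  refine ⟨x, fun u => ?_, hEx⟩
  by_contra hu
  have hu0 : x u = 0 := le_antisymm (not_lt.1 hu) (abs_nonneg _)
  have hsum : ∑ w, (G.dist u w : ℝ) * x w = 0 := by
    have := congrFun hker u
    simp only [Pi.smul_apply, hu0, smul_eq_mul, mul_zero, Matrix.mulVec, dotProduct, distMatrix,
      Matrix.of_apply] at this
    exact this.symm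
  rw [Finset.sum_eq_zero_iff_of_nonneg fun w _ =>
    mul_nonneg (Nat.cast_nonneg _) (abs_nonneg _)] at hsum
  refine hv0 (funext fun w => ?_)
  by_cases hwu : w = u
  · rw [hwu]; exact abs_eq_zero.1 hu0
  · have := hsum w (Finset.mem_univ _)
    have hd : (G.dist u w : ℝ) ≠ 0 := by
      have := hG.pos_dist_of_ne (Ne.symm hwu)
      positivity
    exact abs_eq_zero.1 ((mul_eq_zero.1 this).resolve_left hd)

end SimpleGraph

/-! ### Order 6 and the conclusion -/

theorem distEnergy_placement_le {V : Type*} [Fintype V] {n : ℕ} (hn : Fintype.card V = n)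
    (hpos : 0 < n) {σ : V → ℕ} (hσ : Function.Injective σ) (hσ' : ∀ u, σ u < n) {x : V → ℝ}
    (hx : ∀ u, 0 ≤ x u) :
    distEnergy (fun u v => kiteDist (σ u) (σ v)) Finset.univ x ≤
      (kiteGraph 4 n).distSpectralRadius * ∑ u, x u ^ 2 := by
  have : Nonempty (Fin n) := ⟨⟨0, hpos⟩⟩
  let f : V → Fin n := fun u => ⟨σ u, hσ' u⟩
  have hf : Function.Bijective f := (Fintype.bijective_iff_injective_and_card f).2
    ⟨fun u v h => hσ (congrArg Fin.val h), by rw [hn, Fintype.card_fin]⟩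
  let e := Equiv.ofBijective f hf
  have h1 := (kiteGraph 4 n).distEnergy_le (x ∘ e.symm)
  have h2 : ∑ i, (x ∘ e.symm) i ^ 2 = ∑ u, x u ^ 2 := by
    rw [← Equiv.sum_comp e]; simp
  rw [h2] at h1
  refine le_trans ?_ h1
  unfold distEnergy
  rw [← Equiv.sum_comp e]
  refine Finset.sum_le_sum fun u _ => ?_
  rw [← Equiv.sum_comp e]
  refine Finset.sum_le_sum fun v _ => ?_
  simp only [Function.comp, Equiv.symm_apply_apply]
  refine mul_le_mul_of_nonneg_right ?_ (mul_nonneg (hx u) (hx v))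
  exact_mod_cast kiteDist_le_dist (e u) (e v)

/-- The test vector `![4, 4, 4, 3, 4, 5]` has Rayleigh quotient `844 / 98`, about 8.612. -/
theorem lt_distSpectralRadius_kiteGraph_six :
    (43 / 5 : ℝ) < (kiteGraph 4 6).distSpectralRadius := by
  have h := distEnergy_placement_le (V := Fin 6) (n := 6) (by simp) (by norm_num)
    (σ := Fin.val) Fin.val_injective (fun u => u.2) (x := ![4, 4, 4, 3, 4, 5])
    (by intro u; fin_cases u <;> norm_num)
  unfold distEnergy at h
  norm_num [Fin.sum_univ_succ, kiteDist] at h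
  linarith

/-- This bounds the distance form of the star with five leaves, `L` and `q` being the sum and square
sum of the leaf weights. Its largest eigenvalue is `4 + √21`, about 8.583, just below `43 / 5`. -/
theorem star_form_le {r L q : ℝ} (h : L ^ 2 ≤ 5 * q) :
    2 * (r * L) + 2 * (L ^ 2 - q) ≤ 43 / 5 * (r ^ 2 + q) := by
  nlinarith [sq_nonneg (43 * r - 5 * L), sq_nonneg L]

theorem mainTheorem5 {V : Type*} [Fintype V] [DecidableEq V] (G : SimpleGraph V)
    [DecidableRel G.Adj] (n : ℕ) (hn : Fintype.card V = n) (hG : G.Connected)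
    (hΔ : 5 ≤ G.maxDegree) :
    G.distSpectralRadius < (kiteGraph 4 n).distSpectralRadius := by
  have : Nonempty V := hG.nonempty
  obtain ⟨r, hr⟩ := G.exists_maximal_degree_vertex
  have hdeg : 5 ≤ G.degree r := hr ▸ hΔ
  have hlt := G.degree_lt_card_verts r
  have : Nontrivial V := Fintype.one_lt_card_iff_nontrivial.1 (by omega)
  obtain ⟨x, hx, hE⟩ := hG.exists_perron_vector
  obtain ⟨par, htree⟩ := hG.exists_isRootedTree r
  have hN : (Finset.univ.filter fun u => G.dist r u = 1) = G.neighborFinset r := by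
    ext u
    simp [SimpleGraph.dist_eq_one_iff_adj]
  have hq : 0 < ∑ u, x u ^ 2 := Finset.sum_pos (fun u _ => pow_pos (hx u) 2) Finset.univ_nonempty
  by_cases h6 : n = 6
  · have hcard : (G.neighborFinset r).card = 5 := by
      rw [SimpleGraph.card_neighborFinset_eq_degree]; omega
    have hrN : r ∉ G.neighborFinset r := by simp
    have huniv : insert r (G.neighborFinset r) = Finset.univ := by
      apply Finset.eq_univ_of_card
      rw [Finset.card_insert_of_notMem hrN, hcard, hn, h6]
    have hdep : ∀ u ∈ G.neighborFinset r, G.dist r u = 1 := fun u hu => by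
      rw [← hN] at hu; exact (Finset.mem_filter.1 hu).2
    have hle := star_energy_le htree.symm htree.self hrN (fun u hu => (hdep u hu).le)
      (fun u hu v hv => by
        have := htree.dist_le_of_dep_one (hdep u hu) v
        rwa [hdep v hv] at this) (x := x) (fun u _ => (hx u).le)
    have hcs := sq_sum_le_card_mul_sum_sq (s := G.neighborFinset r) (f := x)
    rw [hcard] at hcs
    have hlast := hle.trans (star_form_le (r := x r) (by exact_mod_cast hcs))
    have hsq : x r ^ 2 + ∑ v ∈ G.neighborFinset r, x v ^ 2 = ∑ u, x u ^ 2 := by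
      rw [← huniv, Finset.sum_insert hrN]
    rw [huniv, hsq, hE] at hlast
    rw [h6]
    exact (le_of_mul_le_mul_right hlast hq).trans_lt lt_distSpectralRadius_kiteGraph_six
  -- The degree bound gives `n ≥ 6`, so here `n ≥ 7` and the subtraction is exact.
  · have hdom := htree.kiteDominated (n - 7) Finset.univ (by rw [Finset.card_univ]; omega)
      (Finset.mem_univ _) (fun _ _ _ => Finset.mem_univ _)
      (by rw [hN, SimpleGraph.card_neighborFinset_eq_degree]; exact hdeg)
    obtain ⟨σ, hσ, hσ', hlt'⟩ := hdom x fun u _ => hx u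
    have hup := distEnergy_placement_le hn (by omega) (σ := σ) (x := x)
      (fun u v h => hσ (Finset.mem_coe.2 (Finset.mem_univ u))
        (Finset.mem_coe.2 (Finset.mem_univ v)) h)
      (fun u => by have := hσ' u (Finset.mem_univ u); rwa [Finset.card_univ, hn] at this)
      (fun u => (hx u).le)
    rw [hE] at hlt'
    exact lt_of_mul_lt_mul_right (hlt'.trans_le hup) hq.le
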